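/- A *host* $H=(\Sigma_H,V_H,E_H)$ consists of finite sets $\Sigma_H$ (symbols) and $V_H$ (nodes) and a set of edges $E_H\subseteq V_H\times\Sigma_H\times V_H$; $\mathrm{out}(x)$ denotes the set of edges with source $x$, and $\mathrm{Path}(x,y)$ the set of nonempty sequences of consecutive edges leading from $x$ to $y$. A *guest* $G=(\Sigma_G,V_G,E_G,M,U,I,C)$ is such a graph with sets $M,U,I\subseteq V_G$ (must, unique, exclusive nodes) and a function $C:V_G\to\mathcal P(\mathcal P(E_G))$ with $\bigcup C(u)=\mathrm{out}(u)$ for all $u$. The product $G\times H$ has alphabet $\Sigma_G\cap\Sigma_H$, nodes $V_G\times V_H$ and the edges $((u,u'),a,(v,v'))$ with $(u,a,v)\in E_G$ and $(u',a,v')\in E_H$. A *loose graph simulation* (LGS) of $G$ in $H$ is a subgraph $S=(\Sigma_G\cap\Sigma_H,V_S,E_S)$ of $G\times H$ such that 1. for every $u\in M$ there is $u'\in V_H$ with $(u,u')\in V_S$; 2. if $u\in U$ and $(u,u'),(u,v')\in V_S$, then $u'=v'$; 3. if $u\in I$ and $(u,u'),(v,u')\in V_S$, then $u=v$; 4. for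 every $(u,u')\in V_S$ there is $\gamma\in C(u)$ such that every $(u,a,v)\in\gamma$ has some $v'\in V_H$ with $((u,u'),a,(v,v'))\in E_S$; and for every $((u,u'),a,(v,v'))\in E_S$ there is such a $\gamma\in C(u)$ that contains $(u,a,v)$; 5. for all $(u,u')\in V_S$ and $v\in M$ with $\mathrm{Path}_G(u,v)\neq\emptyset$ there is $v'\in V_H$ with $\mathrm{Path}_S((u,u'),(v,v'))\ne\emptyset$. The *pruning algorithm* starts with $S=G\times H$ and repeats the following round until a round changes nothing. For each node $(u,u')$ of $S$ (in any order): first, for each edge $((u,u'),a,(v,v'))$ of $S$ going out of it (in any order), remove this edge from $S$ unless there is $\gamma\in C(u)$ with $(u,a,v)\in\gamma$ such that every $(u,b,w)\in\gamma$ has some $w'$ with $((u,u'),b,(w,w'))\in E_S$; then remove the node $(u,u')$ and all edges incident with it if $\mathrm{out}_S((u,u'))=\emptyset$ and $\emptyset\notin C(u)$, or if some $m\in M$ satisfies $\mathrm{Path}_G(u,m)\ne\emptyset$ and $\mathrm{Path}_S((u,u'),(m,v'))=\emptyset$ for all $v'\in V_H$. (All tests refer to the current $S$.) Finally it returns $S$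 if every $m\in M$ occurs in $V_S$ as $(m,v)$ for some $v\in V_H$, and *false* otherwise. **Theorem.** Let $H$ be a host and $G$ a guest with $U=I=\emptyset$. (a) If an LGS of $G$ in $H$ exists, then there is a greatest one with respect to inclusion of graphs. (b) Whatever the orders of its loops, the pruning algorithm halts after at most $|V_{G\times H}|+|E_{G\times H}|+1$ rounds; it returns the greatest LGS if an LGS exists, and *false* otherwise. (c) This is polynomial time in the size of the input $(G,H)$, in which all sets and the choice function are given by explicit lists: each round of the algorithm can be executed in polynomial time, and there is a polynomial-time program that computes from $(G,H)$ the result of the algorithm, i.e. the greatest LGS or *false*. (d) The emptiness problem (is there no LGS of $G$ in $H$?) for guests with $U=I=\emptyset$ is decidable in polynomial time. -/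

import Mathlib

namespace LooseSim

universe u v w

/-! ### Hosts, guests and loose graph simulations -/

/-- A host graph `(Σ, V, E)`: a finite alphabet, a finite set of nodes and a set
`E ⊆ V × Σ × V` of edges. An edge `e = (v, l, v')` has source `e.1`, label `e.2.1` and
target `e.2.2`. -/
@[ext]
structure HostGraph (L : Type u) (N : Type v) where
  symbols : Finset L
  nodes : Finset N
  edges : Finset (N × L × N)
  src_mem : ∀ e ∈ edges, e.1 ∈ nodes
  label_mem : ∀ e ∈ edges, e.2.1 ∈ symbols
  tgt_mem : ∀ e ∈ edges, e.2.2 ∈ nodes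

namespace HostGraph

variable {L : Type u} {N : Type v} {N' : Type w}

/-- Inclusion of graphs. -/
instance : LE (HostGraph L N) :=
  ⟨fun S T => S.symbols ⊆ T.symbols ∧ S.nodes ⊆ T.nodes ∧ S.edges ⊆ T.edges⟩

/-- The outgoing edges of a node. -/
def out [DecidableEq N] (M : HostGraph L N) (x : N) : Finset (N × L × N) :=
  M.edges.filter fun e => e.1 = x

/-- The paths from `x` to `y`: nonempty sequences of consecutive edges that start in `x` and end
in `y`. -/
def paths (M : HostGraph L N) (x y : N) : Set (List (N × L × N)) :=
  {p | (∀ e ∈ p, e ∈ M.edges) ∧ p.IsChain (fun e f => f.1 = e.2.2) ∧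
    (∃ e ∈ p.head?, e.1 = x) ∧ (∃ e ∈ p.getLast?, e.2.2 = y)}

/-- The tensor product of two graphs. -/
def prod [DecidableEq L] [DecidableEq N] [DecidableEq N'] (M₁ : HostGraph L N)
    (M₂ : HostGraph L N') : HostGraph L (N × N') where
  symbols := M₁.symbols ∩ M₂.symbols
  nodes := M₁.nodes ×ˢ M₂.nodes
  edges := ((M₁.edges ×ˢ M₂.edges).filter fun p => p.1.2.1 = p.2.2.1).image
    fun p => ((p.1.1, p.2.1), p.1.2.1, (p.1.2.2, p.2.2.2))
  src_mem := by
    intro e he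
    obtain ⟨p, hp, rfl⟩ := Finset.mem_image.1 he
    have hp := Finset.mem_product.1 (Finset.mem_filter.1 hp).1
    exact Finset.mem_product.2 ⟨M₁.src_mem _ hp.1, M₂.src_mem _ hp.2⟩
  label_mem := by
    intro e he
    obtain ⟨p, hp, rfl⟩ := Finset.mem_image.1 he
    obtain ⟨hp, h⟩ := Finset.mem_filter.1 hp
    have hp := Finset.mem_product.1 hp
    exact Finset.mem_inter.2 ⟨M₁.label_mem _ hp.1, h ▸ M₂.label_mem _ hp.2⟩
  tgt_mem := by
    intro e he
    obtain ⟨p, hp, rfl⟩ := Finset.mem_image.1 he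
    have hp := Finset.mem_product.1 (Finset.mem_filter.1 hp).1
    exact Finset.mem_product.2 ⟨M₁.tgt_mem _ hp.1, M₂.tgt_mem _ hp.2⟩

/-- Remove one edge. -/
def removeEdge [DecidableEq L] [DecidableEq N] (M : HostGraph L N) (e : N × L × N) :
    HostGraph L N where
  symbols := M.symbols
  nodes := M.nodes
  edges := M.edges.erase e
  src_mem f hf := M.src_mem f (Finset.mem_of_mem_erase hf)
  label_mem f hf := M.label_mem f (Finset.mem_of_mem_erase hf)
  tgt_mem f hf := M.tgt_mem f (Finset.mem_of_mem_erase hf)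

/-- Remove one node together with its outgoing and incoming edges. -/
def removeNode [DecidableEq N] (M : HostGraph L N) (x : N) : HostGraph L N where
  symbols := M.symbols
  nodes := M.nodes.erase x
  edges := M.edges.filter fun e => ¬ (e.1 = x ∨ e.2.2 = x)
  src_mem e he := by
    obtain ⟨he, h⟩ := Finset.mem_filter.1 he
    exact Finset.mem_erase.2 ⟨fun hx => h (Or.inl hx), M.src_mem e he⟩
  label_mem e he := M.label_mem e (Finset.mem_filter.1 he).1
  tgt_mem e he := by
    obtain ⟨he, h⟩ := Finset.mem_filter.1 he
    exact Finset.mem_erase.2 ⟨fun hx => h (Or.inr hx), M.tgt_mem e he⟩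

end HostGraph

/-- A guest `(Σ, V, E, M, U, I, C)`: a graph with a must, a unique and an exclusive set of nodes
and a choice function `C` such that `⋃ C(x) = out(x)` for every node `x`. (Values of `choice`
outside the set of nodes are irrelevant.) -/
structure Guest (L : Type u) (N : Type v) extends HostGraph L N where
  must : Finset N
  unique : Finset N
  exclusive : Finset N
  choice : N → Finset (Finset (N × L × N))
  must_subset : must ⊆ nodes
  unique_subset : unique ⊆ nodes
  exclusive_subset : exclusive ⊆ nodes
  choice_union : ∀ x ∈ nodes, ∀ e, (∃ γ ∈ choice x, e ∈ γ) ↔ (e ∈ edges ∧ e.1 = x)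

section LGS

variable {L : Type u} {N : Type v} {N' : Type w} [DecidableEq L] [DecidableEq N] [DecidableEq N']

/-- `S` is a loose graph simulation of the guest `G` in the host `H`. -/
structure IsLGS (G : Guest L N) (H : HostGraph L N') (S : HostGraph L (N × N')) : Prop where
  /-- `S` is a subgraph of `G × H`, over the alphabet `Σ_G ∩ Σ_H`. -/
  symbols_eq : S.symbols = G.symbols ∩ H.symbols
  subgraph : S ≤ G.toHostGraph.prod H
  /-- every must node occurs -/
  must_occurs : ∀ u ∈ G.must, ∃ u' ∈ H.nodes, (u, u') ∈ S.nodes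
  /-- a unique node is assigned to at most one node of the host -/
  unique_occurs : ∀ u ∈ G.unique, ∀ u' v' : N', (u, u') ∈ S.nodes → (u, v') ∈ S.nodes → u' = v'
  /-- a host node assigned to an exclusive node is assigned to no other node -/
  exclusive_occurs : ∀ u ∈ G.exclusive, ∀ (v : N) (u' : N'),
    (u, u') ∈ S.nodes → (v, u') ∈ S.nodes → u = v
  /-- at every node of `S` some choice set is realised -/
  choice_node : ∀ (u : N) (u' : N'), (u, u') ∈ S.nodes → ∃ γ ∈ G.choice u,
    ∀ (a : L) (v : N), (u, a, v) ∈ γ → ∃ v' ∈ H.nodes, ((u, u'), a, (v, v')) ∈ S.edges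
  /-- every edge of `S` belongs to a realised choice set -/
  choice_edge : ∀ (u : N) (u' : N') (a : L) (v : N) (v' : N'),
    ((u, u'), a, (v, v')) ∈ S.edges → ∃ γ ∈ G.choice u, (u, a, v) ∈ γ ∧
      ∀ (b : L) (x : N), (u, b, x) ∈ γ → ∃ x' ∈ H.nodes, ((u, u'), b, (x, x')) ∈ S.edges
  /-- connectivity with respect to must nodes is preserved -/
  must_reach : ∀ (u : N) (u' : N'), (u, u') ∈ S.nodes → ∀ v ∈ G.must,
    (G.paths u v).Nonempty → ∃ v' ∈ H.nodes, (S.paths (u, u') (v, v')).Nonempty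

/-- The set of all loose graph simulations of `G` in `H`. -/
def LGS (G : Guest L N) (H : HostGraph L N') : Set (HostGraph L (N × N')) :=
  {S | IsLGS G H S}

/-! ### The iterative pruning algorithm -/

/-- A way of enumerating finite sets, i.e. the orders in which `foreach` loops run. -/
structure Enumeration (α : Type u) where
  toList : Finset α → List α
  nodup : ∀ s, (toList s).Nodup
  mem_iff : ∀ s a, a ∈ toList s ↔ a ∈ s

/-- The edge `e = ((u, u'), a, (v, v'))` of the current graph `S` lies in a choice set of `u` all
of whose edges are matched by edges of `S` with source `(u, u')`. -/
def EdgeSupported (G : Guest L N) (H : HostGraph L N') (S : HostGraph L (N × N'))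
    (e : (N × N') × L × (N × N')) : Prop :=
  ∃ γ ∈ G.choice e.1.1, (e.1.1, e.2.1, e.2.2.1) ∈ γ ∧
    ∀ (b : L) (x : N), (e.1.1, b, x) ∈ γ →
      ∃ x' : N', (e.1.2, b, x') ∈ H.out e.1.2 ∧ (e.1, b, (x, x')) ∈ S.out e.1

/-- The test for the removal of the node `(u, u')` from the current graph `S`. -/
def NodeRefuted (G : Guest L N) (H : HostGraph L N') (S : HostGraph L (N × N'))
    (x : N × N') : Prop :=
  (S.out x = ∅ ∧ ∅ ∉ G.choice x.1) ∨
    ∃ m ∈ G.must, (G.paths x.1 m).Nonempty ∧ ∀ v' ∈ H.nodes, S.paths x (m, v') = ∅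

open scoped Classical in
/-- Inner loop: run through the outgoing edges of `x` and remove the unsupported ones. -/
noncomputable def pruneEdges (G : Guest L N) (H : HostGraph L N')
    (ordE : Enumeration ((N × N') × L × (N × N'))) (S : HostGraph L (N × N')) (x : N × N') :
    HostGraph L (N × N') :=
  (ordE.toList (S.out x)).foldl
    (fun S e => if EdgeSupported G H S e then S else S.removeEdge e) S

open scoped Classical in
/-- Remove the node `x` if it is refuted. -/
noncomputable def pruneNode (G : Guest L N) (H : HostGraph L N') (S : HostGraph L (N × N'))
    (x : N × N') : HostGraph L (N × N') :=
  if NodeRefuted G H S x then S.removeNode x else S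

/-- One execution of the body of the do-while loop: run through all nodes. -/
noncomputable def pruneRound (G : Guest L N) (H : HostGraph L N') (ordV : Enumeration (N × N'))
    (ordE : Enumeration ((N × N') × L × (N × N'))) (S : HostGraph L (N × N')) :
    HostGraph L (N × N') :=
  (ordV.toList S.nodes).foldl (fun S x => pruneNode G H (pruneEdges G H ordE S x) x) S

/-- `PruneLoop G H ordV ordE S n T`: the do-while loop, entered with the graph `S`, executes its
body `n` times and is left with the graph `T`. It stops as soon as a round changes nothing. -/
inductive PruneLoop (G : Guest L N) (H : HostGraph L N') (ordV : Enumeration (N × N'))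
    (ordE : Enumeration ((N × N') × L × (N × N'))) :
    HostGraph L (N × N') → ℕ → HostGraph L (N × N') → Prop
  | halt (S : HostGraph L (N × N'))
      (hV : (pruneRound G H ordV ordE S).nodes = S.nodes)
      (hE : (pruneRound G H ordV ordE S).edges = S.edges) :
      PruneLoop G H ordV ordE S 1 S
  | again (S T : HostGraph L (N × N')) (n : ℕ)
      (h : (pruneRound G H ordV ordE S).nodes ≠ S.nodes ∨
        (pruneRound G H ordV ordE S).edges ≠ S.edges)
      (hT : PruneLoop G H ordV ordE (pruneRound G H ordV ordE S) n T) :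
      PruneLoop G H ordV ordE S (n + 1) T

open scoped Classical in
/-- The last step: return the graph if every must node occurs in it, and `none` ("false")
otherwise. -/
noncomputable def pruneReturn (G : Guest L N) (H : HostGraph L N') (S : HostGraph L (N × N')) :
    Option (HostGraph L (N × N')) :=
  if ∀ m ∈ G.must, ∃ v ∈ H.nodes, (m, v) ∈ S.nodes then some S else none

/-- The pruning algorithm, started on `G` and `H`, halts after `n` rounds and returns `r`. -/
def PruningRun (G : Guest L N) (H : HostGraph L N') (ordV : Enumeration (N × N'))
    (ordE : Enumeration ((N × N') × L × (N × N'))) (n : ℕ)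
    (r : Option (HostGraph L (N × N'))) : Prop :=
  ∃ T, PruneLoop G H ordV ordE (G.toHostGraph.prod H) n T ∧ r = pruneReturn G H T

end LGS

/-! ### Machine model

Programs of a (variable-free) WHILE language over binary trees, the usual data type of LISP-like
models of computation. Every instruction costs the size of the data that it is applied to, so
that the cost of a run bounds the size of all data produced in it, up to a constant factor, and is
polynomially related to the running time of a Turing machine. -/

/-- Binary trees. -/
inductive Data where
  | nil : Data
  | cons : Data → Data → Data
  deriving DecidableEq

namespace Data

/-- Number of `nil`s and `cons`es. -/
def size : Data → ℕ
  | nil => 1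
  | cons a b => a.size + b.size + 1

def hd : Data → Data
  | nil => nil
  | cons a _ => a

def tl : Data → Data
  | nil => nil
  | cons _ b => b

/-- The truth values are `nil` (false) and `tt` (true). -/
def tt : Data := cons nil nil

/-- Lists of trees as trees. -/
def ofList : List Data → Data
  | [] => nil
  | d :: ds => cons d (ofList ds)

end Data

/-- Programs; each of them transforms one tree into another one. -/
inductive Prog where
  /-- return the input -/
  | id : Prog
  /-- return `nil` -/
  | nil : Prog
  /-- first component -/
  | hd : Prog
  /-- second component -/
  | tl : Prog
  /-- are both components equal? -/
  | eq : Prog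
  /-- run both programs on the input and pair the results -/
  | pair : Prog → Prog → Prog
  /-- run the first program, then the second one on its result -/
  | comp : Prog → Prog → Prog
  /-- `ite c p q`: run `p` if the result of `c` is not `nil`, and `q` otherwise -/
  | ite : Prog → Prog → Prog → Prog
  /-- `loop c p`: as long as the result of `c` is not `nil`, replace the data by the result
  of `p` -/
  | loop : Prog → Prog → Prog

/-- `Runs P x t y`: the program `P`, started on `x`, halts after `t` steps with result `y`. -/
inductive Runs : Prog → Data → ℕ → Data → Prop
  | id (x : Data) : Runs Prog.id x x.size x
  | nil (x : Data) : Runs Prog.nil x x.size Data.nil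
  | hd (x : Data) : Runs Prog.hd x x.size x.hd
  | tl (x : Data) : Runs Prog.tl x x.size x.tl
  | eq (x : Data) : Runs Prog.eq x x.size (if x.hd = x.tl then Data.tt else Data.nil)
  | pair {p q : Prog} {x a b : Data} {m n : ℕ} (hp : Runs p x m a) (hq : Runs q x n b) :
      Runs (Prog.pair p q) x (x.size + m + n) (Data.cons a b)
  | comp {p q : Prog} {x y z : Data} {m n : ℕ} (hp : Runs p x m y) (hq : Runs q y n z) :
      Runs (Prog.comp p q) x (x.size + m + n) z
  | ite_true {c p q : Prog} {x b y : Data} {m n : ℕ} (hc : Runs c x m b) (hb : b ≠ Data.nil)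
      (hp : Runs p x n y) : Runs (Prog.ite c p q) x (x.size + m + n) y
  | ite_false {c p q : Prog} {x y : Data} {m n : ℕ} (hc : Runs c x m Data.nil)
      (hq : Runs q x n y) : Runs (Prog.ite c p q) x (x.size + m + n) y
  | loop_halt {c p : Prog} {x : Data} {m : ℕ} (hc : Runs c x m Data.nil) :
      Runs (Prog.loop c p) x (x.size + m) x
  | loop_again {c p : Prog} {x b y z : Data} {m n k : ℕ} (hc : Runs c x m b)
      (hb : b ≠ Data.nil) (hp : Runs p x n y) (hl : Runs (Prog.loop c p) y k z) :
      Runs (Prog.loop c p) x (x.size + m + n + k) z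

/-- A computational problem, given by the relations "`x` is an input that represents the instance
`i`" and "`y` is a correct output for the instance `i`", is solvable in polynomial time: a single
program solves all instances, in a number of steps polynomial in the size of the input. -/
def PolyTimeSolvable {ι : Type u} (input output : ι → Data → Prop) : Prop :=
  ∃ (P : Prog) (p : Polynomial ℕ), ∀ (i : ι) (x : Data), input i x →
    ∃ (t : ℕ) (y : Data), Runs P x t y ∧ t ≤ p.eval x.size ∧ output i y

/-! ### Representation of graphs

The inputs are graphs whose nodes and symbols are names, i.e. arbitrary trees. Finite sets are
represented by lists without repetition, in any order. -/

/-- `d` lists the elements of `s`, in some order and without repetition, where `R a c` means that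
`c` represents the element `a`. -/
def IsListing {α : Type u} (R : α → Data → Prop) (s : Finset α) (d : Data) : Prop :=
  ∃ (l : List α) (ds : List Data), l.Nodup ∧ (∀ a, a ∈ l ↔ a ∈ s) ∧ List.Forall₂ R l ds ∧
    d = Data.ofList ds

/-- Edges are represented by triples; `nm` is the representation of nodes. -/
def edgeCode {N : Type u} (nm : N → Data) (e : N × Data × N) : Data :=
  Data.cons (nm e.1) (Data.cons e.2.1 (nm e.2.2))

/-- `d` represents the graph `M`, by lists of its symbols, nodes and edges. -/
def IsGraphCode {N : Type u} (nm : N → Data) (M : HostGraph Data N) (d : Data) : Prop :=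
  ∃ dS dV dE : Data, d = Data.cons dS (Data.cons dV dE) ∧
    IsListing (fun a c => c = a) M.symbols dS ∧
    IsListing (fun x c => c = nm x) M.nodes dV ∧
    IsListing (fun e c => c = edgeCode nm e) M.edges dE

/-- `d` represents the guest `G`: the underlying graph, lists of the must, unique and exclusive
nodes, and a list of all pairs of a node and (a list of) its choice sets. -/
def IsGuestCode (G : Guest Data Data) (d : Data) : Prop :=
  ∃ dG dM dU dI dC : Data,
    d = Data.cons dG (Data.cons dM (Data.cons dU (Data.cons dI dC))) ∧
    IsGraphCode (fun x => x) G.toHostGraph dG ∧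
    IsListing (fun x c => c = x) G.must dM ∧
    IsListing (fun x c => c = x) G.unique dU ∧
    IsListing (fun x c => c = x) G.exclusive dI ∧
    IsListing (fun x c => ∃ k, c = Data.cons x k ∧
      IsListing (IsListing fun e c => c = edgeCode (fun x => x) e) (G.choice x) k) G.nodes dC

/-- `d` represents the pair of a guest and a host. -/
def IsInputCode (i : Guest Data Data × HostGraph Data Data) (d : Data) : Prop :=
  ∃ dG dH : Data, d = Data.cons dG dH ∧ IsGuestCode i.1 dG ∧ IsGraphCode (fun x => x) i.2 dH

/-- `d` represents the result of the algorithm: a subgraph of the product, or false (`nil`). -/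
def IsResultCode : Option (HostGraph Data (Data × Data)) → Data → Prop
  | none, d => d = Data.nil
  | some S, d => IsGraphCode (fun x => Data.cons x.1 x.2) S d

/-- The inputs of the fragment: guests whose unique and exclusive sets are empty, and hosts. -/
def IsFragmentInput (i : Guest Data Data × HostGraph Data Data) (d : Data) : Prop :=
  i.1.unique = ∅ ∧ i.1.exclusive = ∅ ∧ IsInputCode i d

/-- The inputs of one round of the algorithm: an input of the fragment and a subgraph of the
product. -/
def IsRoundInput
    (i : (Guest Data Data × HostGraph Data Data) × HostGraph Data (Data × Data)) (d : Data) :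
    Prop :=
  i.2 ≤ i.1.1.toHostGraph.prod i.1.2 ∧ ∃ dI dS : Data, d = Data.cons dI dS ∧
    IsFragmentInput i.1 dI ∧ IsResultCode (some i.2) dS

end LooseSim

open LooseSim

/-!
An edge of a loose graph simulation has a choice set that the simulation realises, and its nodes
reach the must nodes that they have to reach. Both persist in larger graphs, so that no test of the
pruning algorithm, applied to a graph that contains all simulations, leads to the removal of a part
of a simulation; hence every graph that the algorithm visits contains all of them. A round either
removes something or shows that no test fails, so the algorithm halts. A graph on which no test
fails meets every condition on a simulation except the occurrence of the must nodes, which is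
tested at the end and inherited from any simulation inside the graph.

For the running time, graphs are lists of nodes and edges and removals are filters. If the loops of
the algorithm enumerate in the order of the initial lists, then restricting these lists to the
current graph commutes with every step, so the computation on lists is literally a run of the
algorithm. No list ever grows, which bounds the running time of all loops.
-/

namespace LooseSim

universe u v w

section DecreasingFold

variable {α : Type u} {β : Type v} [PartialOrder α] {f : α → β → α}

theorem foldl_le_self (hf : ∀ a b, f a b ≤ a) (l : List β) (a : α) : l.foldl f a ≤ a :=
  l.foldlRecOn (motive := (· ≤ a)) f le_rfl fun a' h b _ => (hf a' b).trans h

theorem eq_self_of_foldl_eq_self (hf : ∀ a b, f a b ≤ a) {l : List β} {a : α}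
    (h : l.foldl f a = a) {b : β} (hb : b ∈ l) : f a b = a := by
  induction l with
  | nil => simp at hb
  | cons c l ih =>
    have hc : f a c = a := (hf a c).antisymm (h.symm.le.trans (foldl_le_self hf l _))
    rcases List.mem_cons.1 hb with rfl | hb
    · exact hc
    · exact ih (by rwa [List.foldl_cons, hc] at h) hb

theorem foldl_comm_of_le {γ : Type w} {φ : α → γ} {g : γ → β → γ} (hf : ∀ a b, f a b ≤ a)
    {l : List β} {a : α} (hφ : ∀ a' ≤ a, ∀ b ∈ l, g (φ a') b = φ (f a' b)) :
    l.foldl g (φ a) = φ (l.foldl f a) := by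
  induction l generalizing a with
  | nil => rfl
  | cons b l ih =>
    rw [List.foldl_cons, hφ a le_rfl b List.mem_cons_self]
    exact ih fun a' ha' c hc => hφ a' (ha'.trans (hf a b)) c (List.mem_cons_of_mem b hc)

end DecreasingFold

namespace HostGraph

variable {L : Type u} {N : Type v}

instance : PartialOrder (HostGraph L N) where
  le_refl _ := ⟨subset_rfl, subset_rfl, subset_rfl⟩
  le_trans _ _ _ h h' := ⟨h.1.trans h'.1, h.2.1.trans h'.2.1, h.2.2.trans h'.2.2⟩
  le_antisymm _ _ h h' :=
    HostGraph.ext (h.1.antisymm h'.1) (h.2.1.antisymm h'.2.1) (h.2.2.antisymm h'.2.2)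

theorem mem_out [DecidableEq N] {S : HostGraph L N} {x : N} {e : N × L × N} :
    e ∈ S.out x ↔ e ∈ S.edges ∧ e.1 = x :=
  Finset.mem_filter

theorem paths_mono {S T : HostGraph L N} (h : S ≤ T) (x y : N) : S.paths x y ⊆ T.paths x y :=
  fun _ hp => ⟨fun e he => h.2.2 (hp.1 e he), hp.2⟩

theorem mem_prod_edges {N' : Type w} [DecidableEq L] [DecidableEq N] [DecidableEq N']
    {G : HostGraph L N} {H : HostGraph L N'} {e : (N × N') × L × (N × N')} :
    e ∈ (G.prod H).edges ↔
      (e.1.1, e.2.1, e.2.2.1) ∈ G.edges ∧ (e.1.2, e.2.1, e.2.2.2) ∈ H.edges := by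
  simp only [prod, Finset.mem_image, Finset.mem_filter, Finset.mem_product]
  constructor
  · rintro ⟨⟨⟨u, a, v⟩, ⟨u', a', v'⟩⟩, ⟨h, ha⟩, rfl⟩
    obtain rfl : a = a' := ha
    exact h
  · exact fun h => ⟨(_, _), ⟨h, rfl⟩, rfl⟩

theorem removeEdge_le [DecidableEq L] [DecidableEq N] (S : HostGraph L N) (e : N × L × N) :
    S.removeEdge e ≤ S :=
  ⟨subset_rfl, subset_rfl, Finset.erase_subset _ _⟩

theorem removeNode_le [DecidableEq N] (S : HostGraph L N) (x : N) : S.removeNode x ≤ S :=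
  ⟨subset_rfl, Finset.erase_subset _ _, Finset.filter_subset _ _⟩

theorem le_removeEdge [DecidableEq L] [DecidableEq N] {S T : HostGraph L N} {e : N × L × N}
    (h : T ≤ S) (he : e ∉ T.edges) : T ≤ S.removeEdge e :=
  ⟨h.1, h.2.1, Finset.subset_erase.2 ⟨h.2.2, he⟩⟩

theorem le_removeNode [DecidableEq N] {S T : HostGraph L N} {x : N}
    (h : T ≤ S) (hx : x ∉ T.nodes) : T ≤ S.removeNode x := by
  refine ⟨h.1, Finset.subset_erase.2 ⟨h.2.1, hx⟩,
    fun e he => Finset.mem_filter.2 ⟨h.2.2 he, ?_⟩⟩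
  rintro (rfl | rfl)
  · exact hx (T.src_mem e he)
  · exact hx (T.tgt_mem e he)

/-- The number of nodes and edges, which bounds the number of rounds of the pruning algorithm. -/
def card (S : HostGraph L N) : ℕ := S.nodes.card + S.edges.card

theorem card_lt_card {S T : HostGraph L N} (h : S < T) (hs : S.symbols = T.symbols) :
    S.card < T.card := by
  have hV := Finset.card_le_card h.le.2.1
  have hE := Finset.card_le_card h.le.2.2
  refine (add_le_add hV hE).lt_of_ne fun hcard => h.ne ?_
  exact HostGraph.ext hs (Finset.eq_of_subset_of_card_le h.le.2.1 (by lia))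
    (Finset.eq_of_subset_of_card_le h.le.2.2 (by lia))

end HostGraph

/-! ### Correctness of the pruning algorithm -/

section NodePruning

variable {L : Type u} {N : Type v} {N' : Type w} [DecidableEq N] [DecidableEq N']
  (G : Guest L N) (H : HostGraph L N')

theorem pruneNode_le (S : HostGraph L (N × N')) (x : N × N') : pruneNode G H S x ≤ S := by
  unfold pruneNode
  split_ifs
  · exact S.removeNode_le x
  · exact le_rfl

theorem pruneNode_symbols (S : HostGraph L (N × N')) (x : N × N') :
    (pruneNode G H S x).symbols = S.symbols := by
  unfold pruneNode
  split_ifs <;> rfl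

theorem not_nodeRefuted_of_pruneNode_eq_self {S : HostGraph L (N × N')} {x : N × N'}
    (h : pruneNode G H S x = S) (hx : x ∈ S.nodes) : ¬ NodeRefuted G H S x := by
  intro hr
  rw [pruneNode, if_pos hr] at h
  exact Finset.erase_eq_self.1 (congrArg HostGraph.nodes h) hx

end NodePruning

section Pruning

variable {L : Type u} {N : Type v} {N' : Type w} [DecidableEq L] [DecidableEq N] [DecidableEq N']

section Decreasing

variable (G : Guest L N) (H : HostGraph L N') (ordV : Enumeration (N × N'))
  (ordE : Enumeration ((N × N') × L × (N × N'))) (S : HostGraph L (N × N'))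

open scoped Classical in
theorem ite_edgeSupported_le (e : (N × N') × L × (N × N')) :
    (if EdgeSupported G H S e then S else S.removeEdge e) ≤ S := by
  split_ifs
  · exact le_rfl
  · exact S.removeEdge_le e

theorem pruneEdges_le (x : N × N') : pruneEdges G H ordE S x ≤ S :=
  foldl_le_self (ite_edgeSupported_le G H) _ S

theorem pruneEdges_symbols (x : N × N') : (pruneEdges G H ordE S x).symbols = S.symbols :=
  List.foldlRecOn (motive := fun T : HostGraph L (N × N') => T.symbols = S.symbols) _ _ rfl
    fun T hT e _ => by split_ifs <;> exact hT

theorem pruneNode_pruneEdges_le (x : N × N') :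
    pruneNode G H (pruneEdges G H ordE S x) x ≤ S :=
  (pruneNode_le G H _ x).trans (pruneEdges_le G H ordE S x)

theorem pruneRound_le : pruneRound G H ordV ordE S ≤ S :=
  foldl_le_self (pruneNode_pruneEdges_le G H ordE) _ S

theorem iterate_pruneRound_le (n : ℕ) : (pruneRound G H ordV ordE)^[n] S ≤ S := by
  induction n with
  | zero => exact le_rfl
  | succ n ih =>
    rw [Function.iterate_succ_apply']
    exact (pruneRound_le G H ordV ordE _).trans ih

theorem pruneRound_symbols : (pruneRound G H ordV ordE S).symbols = S.symbols :=
  List.foldlRecOn (motive := fun T : HostGraph L (N × N') => T.symbols = S.symbols) _ _ rfl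
    fun T hT x _ =>
      (pruneNode_symbols G H _ x).trans ((pruneEdges_symbols G H ordE T x).trans hT)

end Decreasing

variable {G : Guest L N} {H : HostGraph L N'} {ordV : Enumeration (N × N')}
  {ordE : Enumeration ((N × N') × L × (N × N'))} {S T : HostGraph L (N × N')}
  {r r' : Option (HostGraph L (N × N'))}

namespace IsLGS

theorem edgeSupported (hT : IsLGS G H T) (hS : T ≤ S) {e : (N × N') × L × (N × N')}
    (he : e ∈ T.edges) : EdgeSupported G H S e := by
  obtain ⟨⟨u, u'⟩, a, ⟨v, v'⟩⟩ := e
  obtain ⟨γ, hγ, haγ, h⟩ := hT.choice_edge u u' a v v' he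
  refine ⟨γ, hγ, haγ, fun b x hb => ?_⟩
  obtain ⟨x', -, hx⟩ := h b x hb
  exact ⟨x', HostGraph.mem_out.2 ⟨(HostGraph.mem_prod_edges.1 (hT.subgraph.2.2 hx)).2, rfl⟩,
    HostGraph.mem_out.2 ⟨hS.2.2 hx, rfl⟩⟩

theorem empty_mem_choice_of_out_eq_empty (hT : IsLGS G H T) {x : N × N'} (hx : x ∈ T.nodes)
    (hout : T.out x = ∅) : ∅ ∈ G.choice x.1 := by
  obtain ⟨u, u'⟩ := x
  obtain ⟨γ, hγ, h⟩ := hT.choice_node u u' hx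
  obtain rfl | ⟨⟨w, a, v⟩, he⟩ := γ.eq_empty_or_nonempty
  · exact hγ
  · obtain rfl : w = u := ((G.choice_union u (Finset.mem_product.1 (hT.subgraph.2.1 hx)).1 _).1
      ⟨γ, hγ, he⟩).2
    obtain ⟨v', -, hv⟩ := h a v he
    exact absurd (HostGraph.mem_out.2 ⟨hv, rfl⟩) (by simp [hout])

theorem not_nodeRefuted (hT : IsLGS G H T) (hS : T ≤ S) {x : N × N'} (hx : x ∈ T.nodes) :
    ¬ NodeRefuted G H S x := by
  rintro (⟨hout, hC⟩ | ⟨m, hm, hp, h⟩)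
  · have hsub : T.out x ⊆ S.out x := Finset.filter_subset_filter _ hS.2.2
    exact hC (hT.empty_mem_choice_of_out_eq_empty hx (Finset.subset_empty.1 (hout ▸ hsub)))
  · obtain ⟨v', hv', p, hp'⟩ := hT.must_reach x.1 x.2 hx m hm hp
    exact Set.eq_empty_iff_forall_notMem.1 (h v' hv') p (HostGraph.paths_mono hS _ _ hp')

theorem le_pruneEdges (hT : IsLGS G H T) (hS : T ≤ S) (x : N × N') :
    T ≤ pruneEdges G H ordE S x := by
  refine List.foldlRecOn (motive := (T ≤ ·)) _ _ hS fun S hS e _ => ?_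
  split_ifs with h
  · exact hS
  · exact HostGraph.le_removeEdge hS fun he => h (hT.edgeSupported hS he)

theorem le_pruneNode (hT : IsLGS G H T) (hS : T ≤ S) (x : N × N') : T ≤ pruneNode G H S x := by
  unfold pruneNode
  split_ifs with h
  · exact HostGraph.le_removeNode hS fun hx => hT.not_nodeRefuted hS hx h
  · exact hS

theorem le_pruneRound (hT : IsLGS G H T) (hS : T ≤ S) : T ≤ pruneRound G H ordV ordE S :=
  List.foldlRecOn (motive := (T ≤ ·)) _ _ hS fun _ hS x _ =>
    hT.le_pruneNode (hT.le_pruneEdges hS x) x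

end IsLGS

/-- No test of the pruning algorithm leads to a removal. -/
def IsStable (G : Guest L N) (H : HostGraph L N') (S : HostGraph L (N × N')) : Prop :=
  (∀ e ∈ S.edges, EdgeSupported G H S e) ∧ ∀ x ∈ S.nodes, ¬ NodeRefuted G H S x

theorem edgeSupported_of_pruneEdges_eq_self {x : N × N'} (h : pruneEdges G H ordE S x = S)
    {e : (N × N') × L × (N × N')} (he : e ∈ S.out x) : EdgeSupported G H S e := by
  by_contra hsup
  have hstep := eq_self_of_foldl_eq_self (ite_edgeSupported_le G H) h ((ordE.mem_iff _ _).2 he)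
  rw [if_neg hsup] at hstep
  exact Finset.erase_eq_self.1 (congrArg HostGraph.edges hstep) (HostGraph.mem_out.1 he).1

theorem isStable_of_pruneRound_eq_self (h : pruneRound G H ordV ordE S = S) :
    IsStable G H S := by
  have hstep : ∀ x ∈ S.nodes, pruneNode G H (pruneEdges G H ordE S x) x = S := fun x hx =>
    eq_self_of_foldl_eq_self (pruneNode_pruneEdges_le G H ordE) h ((ordV.mem_iff _ _).2 hx)
  have hE : ∀ x ∈ S.nodes, pruneEdges G H ordE S x = S := fun x hx =>
    (pruneEdges_le G H ordE S x).antisymm ((hstep x hx).symm.le.trans (pruneNode_le G H _ x))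
  refine ⟨fun e he => edgeSupported_of_pruneEdges_eq_self (hE e.1 (S.src_mem e he))
    (HostGraph.mem_out.2 ⟨he, rfl⟩), fun x hx => ?_⟩
  exact not_nodeRefuted_of_pruneNode_eq_self G H (by simpa only [hE x hx] using hstep x hx) hx

/-- `S` is a subgraph of the product that contains all loose graph simulations; this is the
invariant of the pruning algorithm. -/
structure IsUpperApprox (G : Guest L N) (H : HostGraph L N') (S : HostGraph L (N × N')) :
    Prop where
  symbols_eq : S.symbols = G.symbols ∩ H.symbols
  le_prod : S ≤ G.toHostGraph.prod H
  le_of_isLGS : ∀ T, IsLGS G H T → T ≤ S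

theorem isUpperApprox_prod (G : Guest L N) (H : HostGraph L N') :
    IsUpperApprox G H (G.toHostGraph.prod H) :=
  ⟨rfl, le_rfl, fun _ hT => hT.subgraph⟩

theorem IsUpperApprox.pruneRound (hS : IsUpperApprox G H S) :
    IsUpperApprox G H (pruneRound G H ordV ordE S) :=
  ⟨(pruneRound_symbols G H ordV ordE S).trans hS.symbols_eq,
    (pruneRound_le G H ordV ordE S).trans hS.le_prod,
    fun T hT => hT.le_pruneRound (hS.le_of_isLGS T hT)⟩

theorem PruneLoop.isUpperApprox {n : ℕ} (h : PruneLoop G H ordV ordE S n T)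
    (hS : IsUpperApprox G H S) : IsUpperApprox G H T := by
  induction h with
  | halt => exact hS
  | again _ _ _ _ _ ih => exact ih hS.pruneRound

theorem PruneLoop.isStable {n : ℕ} (h : PruneLoop G H ordV ordE S n T) : IsStable G H T := by
  induction h with
  | halt S hV hE =>
    exact isStable_of_pruneRound_eq_self
      (HostGraph.ext (pruneRound_symbols G H ordV ordE S) hV hE)
  | again _ _ _ _ _ ih => exact ih

/-- Iterating a round any sufficient number of times gives the graph with which the do-while loop
ends, so that programs may use a bounded loop. -/
theorem exists_pruneLoop_iterate (ordV : Enumeration (N × N'))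
    (ordE : Enumeration ((N × N') × L × (N × N'))) {k : ℕ} (hk : S.card ≤ k) :
    ∃ n ≤ S.card + 1, PruneLoop G H ordV ordE S n ((pruneRound G H ordV ordE)^[k] S) := by
  induction k generalizing S with
  | zero =>
    have h : pruneRound G H ordV ordE S = S := by
      by_contra h
      have := HostGraph.card_lt_card ((pruneRound_le G H ordV ordE S).lt_of_ne h)
        (pruneRound_symbols G H ordV ordE S)
      lia
    exact ⟨1, by lia, .halt S (by rw [h]) (by rw [h])⟩
  | succ k ih =>
    by_cases h : pruneRound G H ordV ordE S = S
    · rw [Function.iterate_fixed h]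
      exact ⟨1, by lia, .halt S (by rw [h]) (by rw [h])⟩
    · have hlt := HostGraph.card_lt_card ((pruneRound_le G H ordV ordE S).lt_of_ne h)
        (pruneRound_symbols G H ordV ordE S)
      obtain ⟨n, hn, hloop⟩ := ih (S := pruneRound G H ordV ordE S) (by lia)
      refine ⟨n + 1, by lia, .again S _ n ?_ hloop⟩
      by_contra! h'
      exact h (HostGraph.ext (pruneRound_symbols G H ordV ordE S) h'.1 h'.2)

theorem IsUpperApprox.isLGS (hS : IsUpperApprox G H S) (hU : G.unique = ∅) (hI : G.exclusive = ∅)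
    (h : IsStable G H S) (hM : ∀ m ∈ G.must, ∃ v ∈ H.nodes, (m, v) ∈ S.nodes) :
    IsLGS G H S where
  symbols_eq := hS.symbols_eq
  subgraph := hS.le_prod
  must_occurs := hM
  unique_occurs := by simp [hU]
  exclusive_occurs := by simp [hI]
  choice_node u u' hu := by
    by_cases hC : ∅ ∈ G.choice u
    · exact ⟨∅, hC, by simp⟩
    · have hout : S.out (u, u') ≠ ∅ := fun hout => h.2 _ hu (Or.inl ⟨hout, hC⟩)
      obtain ⟨e, he⟩ := Finset.nonempty_iff_ne_empty.2 hout
      obtain ⟨he, heu⟩ := HostGraph.mem_out.1 he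
      obtain ⟨γ, hγ, -, hsup⟩ := h.1 e he
      rw [heu] at hγ hsup
      refine ⟨γ, hγ, fun a v hav => ?_⟩
      obtain ⟨v', hv', hv⟩ := hsup a v hav
      exact ⟨v', H.tgt_mem _ (HostGraph.mem_out.1 hv').1, (HostGraph.mem_out.1 hv).1⟩
  choice_edge u u' a v v' he := by
    obtain ⟨γ, hγ, haγ, hsup⟩ := h.1 _ he
    refine ⟨γ, hγ, haγ, fun b x hb => ?_⟩
    obtain ⟨x', hx', hx⟩ := hsup b x hb
    exact ⟨x', H.tgt_mem _ (HostGraph.mem_out.1 hx').1, (HostGraph.mem_out.1 hx).1⟩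
  must_reach u u' hu m hm hp := by
    by_contra! hc
    exact h.2 _ hu (Or.inr ⟨m, hm, hp, hc⟩)

/-- The specification of the pruning algorithm: `r` is the greatest loose graph simulation, or
`none` if there is no loose graph simulation. -/
def IsPruningResult (G : Guest L N) (H : HostGraph L N') (r : Option (HostGraph L (N × N'))) :
    Prop :=
  (∀ S, r = some S ↔ IsGreatest (LGS G H) S) ∧ (r = none ↔ LGS G H = ∅)

theorem isPruningResult_some_iff : IsPruningResult G H (some S) ↔ IsGreatest (LGS G H) S := by
  refine ⟨fun h => (h.1 S).1 rfl, fun h => ⟨fun T => ?_, ?_⟩⟩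
  · exact ⟨fun hT => Option.some.inj hT ▸ h, fun hT => congrArg some (h.unique hT)⟩
  · simpa using h.nonempty.ne_empty

theorem isPruningResult_none_iff : IsPruningResult G H none ↔ LGS G H = ∅ :=
  ⟨fun h => h.2.1 rfl, fun h => ⟨fun T => by simp [h, IsGreatest], by simp [h]⟩⟩

theorem IsUpperApprox.isPruningResult_pruneReturn (hS : IsUpperApprox G H S)
    (hU : G.unique = ∅) (hI : G.exclusive = ∅) (h : IsStable G H S) :
    IsPruningResult G H (pruneReturn G H S) := by
  unfold pruneReturn
  split_ifs with hM
  · exact isPruningResult_some_iff.2 ⟨hS.isLGS hU hI h hM, hS.le_of_isLGS⟩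
  · refine isPruningResult_none_iff.2 (Set.eq_empty_of_forall_notMem fun T hT => hM fun m hm => ?_)
    obtain ⟨v, hv, hmv⟩ := hT.must_occurs m hm
    exact ⟨v, hv, (hS.le_of_isLGS T hT).2.1 hmv⟩

theorem PruningRun.isPruningResult {n : ℕ} (h : PruningRun G H ordV ordE n r)
    (hU : G.unique = ∅) (hI : G.exclusive = ∅) : IsPruningResult G H r := by
  obtain ⟨T, hT, rfl⟩ := h
  exact (hT.isUpperApprox (isUpperApprox_prod G H)).isPruningResult_pruneReturn hU hI hT.isStable

theorem exists_pruningRun_iterate (G : Guest L N) (H : HostGraph L N')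
    (ordV : Enumeration (N × N')) (ordE : Enumeration ((N × N') × L × (N × N'))) {k : ℕ}
    (hk : (G.toHostGraph.prod H).card ≤ k) :
    ∃ n ≤ (G.toHostGraph.prod H).card + 1, PruningRun G H ordV ordE n
      (pruneReturn G H ((pruneRound G H ordV ordE)^[k] (G.toHostGraph.prod H))) := by
  obtain ⟨n, hn, h⟩ := exists_pruneLoop_iterate ordV ordE hk
  exact ⟨n, hn, _, h, rfl⟩

theorem IsPruningResult.unique (h : IsPruningResult G H r) (h' : IsPruningResult G H r') :
    r = r' := by
  cases r with
  | none => exact (h'.2.2 (h.2.1 rfl)).symm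
  | some S => exact ((h'.1 S).2 ((h.1 S).1 rfl)).symm

instance (α : Type u) : Nonempty (Enumeration α) :=
  ⟨⟨Finset.toList, Finset.nodup_toList, fun _ _ => Finset.mem_toList⟩⟩

theorem exists_isGreatest_of_nonempty (hU : G.unique = ∅) (hI : G.exclusive = ∅)
    (hne : (LGS G H).Nonempty) : ∃ S, IsGreatest (LGS G H) S := by
  obtain ⟨n, -, hrun⟩ := exists_pruningRun_iterate G H (Classical.arbitrary _)
    (Classical.arbitrary _) le_rfl
  have hr := hrun.isPruningResult hU hI
  obtain ⟨S, hS⟩ := Option.ne_none_iff_exists'.1 fun hnone => hne.ne_empty (hr.2.1 hnone)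
  exact ⟨S, (hr.1 S).1 hS⟩

end Pruning

/-! ### Polynomial-time functions -/

namespace Data

theorem one_le_size (x : Data) : 1 ≤ x.size := by cases x <;> simp [size]

theorem size_hd_le (x : Data) : x.hd.size ≤ x.size := by
  cases x <;> simp only [size, hd] <;> lia

theorem size_tl_le (x : Data) : x.tl.size ≤ x.size := by
  cases x <;> simp only [size, tl] <;> lia

theorem ofList_injective : Function.Injective ofList := by
  intro k
  induction k with
  | nil => intro l h; cases l <;> simp_all [ofList]
  | cons x k ih =>
    intro l h
    cases l with
    | nil => simp [ofList] at h
    | cons y l =>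
      simp only [ofList, cons.injEq] at h
      rw [h.1, ih h.2]

end Data

theorem Runs.size_le {P : Prog} {x y : Data} {t : ℕ} (h : Runs P x t y) : y.size ≤ 3 * t := by
  induction h with
  | hd x => have := x.size_hd_le; lia
  | tl x => have := x.size_tl_le; lia
  | nil x => have := x.one_le_size; simp only [Data.size]; lia
  | eq x => have := x.one_le_size; split_ifs <;> simp only [Data.tt, Data.size] <;> lia
  | @pair _ _ x => have := x.one_le_size; simp only [Data.size]; lia
  | _ => lia

/-- The program `P`, started on `x`, halts within `b` steps with result `y`. -/
def RunsIn (P : Prog) (x : Data) (b : ℕ) (y : Data) : Prop :=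
  ∃ t ≤ b, Runs P x t y

namespace RunsIn

variable {P Q R : Prog} {w x y z : Data} {m n k : ℕ}

theorem mono (h : RunsIn P x m y) (hmn : m ≤ n) : RunsIn P x n y :=
  let ⟨t, htm, ht⟩ := h
  ⟨t, htm.trans hmn, ht⟩

theorem size_le (h : RunsIn P x m y) : y.size ≤ 3 * m :=
  let ⟨_, htm, ht⟩ := h
  ht.size_le.trans (Nat.mul_le_mul_left 3 htm)

theorem id : RunsIn .id x x.size x := ⟨_, le_rfl, .id x⟩

theorem nil : RunsIn .nil x x.size .nil := ⟨_, le_rfl, .nil x⟩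

theorem hd : RunsIn .hd x x.size x.hd := ⟨_, le_rfl, .hd x⟩

theorem tl : RunsIn .tl x x.size x.tl := ⟨_, le_rfl, .tl x⟩

theorem eq : RunsIn .eq x x.size (if x.hd = x.tl then .tt else .nil) := ⟨_, le_rfl, .eq x⟩

theorem pair (hP : RunsIn P x m y) (hQ : RunsIn Q x n z) :
    RunsIn (.pair P Q) x (x.size + m + n) (.cons y z) :=
  let ⟨_, hs, hP⟩ := hP
  let ⟨_, ht, hQ⟩ := hQ
  ⟨_, by gcongr, .pair hP hQ⟩

theorem comp (hP : RunsIn P x m y) (hQ : RunsIn Q y n z) :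
    RunsIn (.comp P Q) x (x.size + m + n) z :=
  let ⟨_, hs, hP⟩ := hP
  let ⟨_, ht, hQ⟩ := hQ
  ⟨_, by gcongr, .comp hP hQ⟩

theorem ite_true (hP : RunsIn P x m y) (hy : y ≠ .nil) (hQ : RunsIn Q x n z) :
    RunsIn (.ite P Q R) x (x.size + m + n) z :=
  let ⟨_, hs, hP⟩ := hP
  let ⟨_, ht, hQ⟩ := hQ
  ⟨_, by gcongr, .ite_true hP hy hQ⟩

theorem ite_false (hP : RunsIn P x m .nil) (hR : RunsIn R x n z) :
    RunsIn (.ite P Q R) x (x.size + m + n) z :=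
  let ⟨_, hs, hP⟩ := hP
  let ⟨_, ht, hR⟩ := hR
  ⟨_, by gcongr, .ite_false hP hR⟩

theorem loop_halt (hP : RunsIn P x m .nil) : RunsIn (.loop P Q) x (x.size + m) x :=
  let ⟨_, hs, hP⟩ := hP
  ⟨_, by gcongr, .loop_halt hP⟩

theorem loop_again (hP : RunsIn P x m w) (hw : w ≠ .nil) (hQ : RunsIn Q x n y)
    (hl : RunsIn (.loop P Q) y k z) : RunsIn (.loop P Q) x (x.size + m + n + k) z :=
  let ⟨_, hr, hP⟩ := hP
  let ⟨_, hs, hQ⟩ := hQ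
  let ⟨_, ht, hl⟩ := hl
  ⟨_, by gcongr, .loop_again hP hw hQ hl⟩

end RunsIn

/-- Types whose elements are encoded by trees, so that programs compute functions between them. -/
class DataEncoding (α : Type u) where
  /-- The tree that encodes an element. -/
  code : α → Data
  code_injective : Function.Injective code

open DataEncoding

instance : DataEncoding Data where
  code x := x
  code_injective _ _ h := h

instance : DataEncoding Bool where
  code b := bif b then .tt else .nil
  code_injective := by intro a b; cases a <;> cases b <;> simp [Data.tt]

instance {α : Type u} {β : Type v} [DataEncoding α] [DataEncoding β] : DataEncoding (α × β) where
  code a := .cons (code a.1) (code a.2)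
  code_injective _ _ h :=
    Prod.ext (code_injective (Data.cons.inj h).1) (code_injective (Data.cons.inj h).2)

instance {α : Type u} [DataEncoding α] : DataEncoding (List α) where
  code l := Data.ofList (l.map code)
  code_injective := Data.ofList_injective.comp (List.map_injective_iff.2 code_injective)

section CodeSize

variable {α : Type u} {β : Type v} [DataEncoding α] [DataEncoding β]

/-- The size of the tree that encodes `a`. -/
abbrev codeSize (a : α) : ℕ := (code a).size

theorem code_pair (a : α) (b : β) : code (a, b) = .cons (code a) (code b) := rfl

theorem code_nil : code ([] : List α) = .nil := rfl

theorem code_cons (a : α) (l : List α) : code (a :: l) = .cons (code a) (code l) := rfl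

theorem codeSize_pair (a : α) (b : β) : codeSize (a, b) = codeSize a + codeSize b + 1 := rfl

theorem codeSize_nil : codeSize ([] : List α) = 1 := rfl

theorem codeSize_cons (a : α) (l : List α) :
    codeSize (a :: l) = codeSize a + codeSize l + 1 := rfl

theorem codeSize_append (k l : List α) : codeSize (k ++ l) + 1 = codeSize k + codeSize l := by
  induction k with
  | nil => rw [List.nil_append, codeSize_nil, add_comm]
  | cons a k ih => rw [List.cons_append, codeSize_cons, codeSize_cons]; lia

theorem codeSize_le_of_sublist {k l : List α} (h : k.Sublist l) : codeSize k ≤ codeSize l := by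
  induction h with
  | slnil => exact le_rfl
  | cons _ _ ih => rw [codeSize_cons]; lia
  | cons_cons _ _ ih => rw [codeSize_cons, codeSize_cons]; lia

theorem codeSize_filter_le (p : α → Bool) (l : List α) : codeSize (l.filter p) ≤ codeSize l :=
  codeSize_le_of_sublist List.filter_sublist

theorem codeSize_reverse (l : List α) : codeSize l.reverse = codeSize l := by
  induction l with
  | nil => rfl
  | cons a l ih =>
    have := codeSize_append l.reverse [a]
    rw [codeSize_cons, codeSize_nil] at this
    rw [List.reverse_cons, codeSize_cons]
    lia

theorem length_lt_codeSize (l : List α) : l.length < codeSize l := by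
  induction l with
  | nil => exact one_pos
  | cons a l ih => rw [codeSize_cons, List.length_cons]; lia

theorem codeSize_lt_of_mem {a : α} {l : List α} (h : a ∈ l) : codeSize a < codeSize l := by
  induction l with
  | nil => simp at h
  | cons b l ih =>
    rw [codeSize_cons]
    rcases List.mem_cons.1 h with rfl | h
    · lia
    · exact (ih h).trans (by lia)

theorem codeSize_flatMap_le {α : Type w} {f : α → List β} {l : List α} {b : ℕ}
    (h : ∀ a ∈ l, codeSize (f a) ≤ b) : codeSize (l.flatMap f) ≤ l.length * b + 1 := by
  induction l with
  | nil => simp [codeSize_nil]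
  | cons a l ih =>
    rw [List.forall_mem_cons] at h
    have := codeSize_append (f a) (l.flatMap f)
    have := ih h.2
    rw [List.flatMap_cons, List.length_cons, Nat.succ_mul]
    lia

end CodeSize

theorem eval_mono (p : Polynomial ℕ) : Monotone fun n => p.eval n := by
  intro m n h
  simp only [Polynomial.eval_eq_sum]
  exact Finset.sum_le_sum fun i _ => Nat.mul_le_mul_left _ (Nat.pow_le_pow_left h i)

section PolyBounded

variable {α : Type u} [DataEncoding α] {s t : α → ℕ}

/-- `t` is bounded by a polynomial in the size of the encoding of its argument. -/
@[fun_prop]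
def PolyBounded (t : α → ℕ) : Prop :=
  ∃ p : Polynomial ℕ, ∀ a, t a ≤ p.eval (codeSize a)

namespace PolyBounded

theorem mono (ht : PolyBounded t) (hst : ∀ a, s a ≤ t a) : PolyBounded s :=
  let ⟨p, hp⟩ := ht
  ⟨p, fun a => (hst a).trans (hp a)⟩

@[fun_prop]
theorem codeSize : PolyBounded fun a : α => codeSize a := ⟨.X, fun a => by simp⟩

@[fun_prop]
theorem const (n : ℕ) : PolyBounded fun _ : α => n := ⟨.C n, fun a => by simp⟩

@[fun_prop]
theorem add (hs : PolyBounded s) (ht : PolyBounded t) : PolyBounded fun a => s a + t a :=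
  let ⟨p, hp⟩ := hs
  let ⟨q, hq⟩ := ht
  ⟨p + q, fun a => by simpa using add_le_add (hp a) (hq a)⟩

@[fun_prop]
theorem mul (hs : PolyBounded s) (ht : PolyBounded t) : PolyBounded fun a => s a * t a :=
  let ⟨p, hp⟩ := hs
  let ⟨q, hq⟩ := ht
  ⟨p * q, fun a => by simpa using Nat.mul_le_mul (hp a) (hq a)⟩

@[fun_prop]
theorem eval (p : Polynomial ℕ) (ht : PolyBounded t) : PolyBounded fun a => p.eval (t a) :=
  let ⟨q, hq⟩ := ht
  ⟨p.comp q, fun a => by simpa using eval_mono p (hq a)⟩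

end PolyBounded

end PolyBounded

/-- `f` is computed by a program in polynomial time. -/
@[fun_prop]
def PolyTime {α : Type u} {β : Type v} [DataEncoding α] [DataEncoding β] (f : α → β) : Prop :=
  ∃ (P : Prog) (p : Polynomial ℕ), ∀ a, RunsIn P (code a) (p.eval (codeSize a)) (code (f a))

section PolyTime

variable {α : Type u} {β : Type v} {γ : Type w} [DataEncoding α] [DataEncoding β] [DataEncoding γ]

@[fun_prop]
theorem PolyBounded.codeSize_apply {f : α → β} (hf : PolyTime f) :
    PolyBounded fun a => LooseSim.codeSize (f a) :=
  let ⟨_, p, h⟩ := hf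
  ⟨3 * p, fun a => by simpa using (h a).size_le⟩

namespace PolyTime

theorem of_runsIn {f : α → β} {P : Prog} {t : α → ℕ} (ht : PolyBounded t)
    (h : ∀ a, RunsIn P (code a) (t a) (code (f a))) : PolyTime f :=
  let ⟨p, hp⟩ := ht
  ⟨P, p, fun a => (h a).mono (hp a)⟩

theorem exists_runsIn {f : α → β} (hf : PolyTime f) :
    ∃ (P : Prog) (t : α → ℕ), PolyBounded t ∧ ∀ a, RunsIn P (code a) (t a) (code (f a)) :=
  let ⟨P, p, h⟩ := hf
  ⟨P, _, ⟨p, fun _ => le_rfl⟩, h⟩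

@[fun_prop]
theorem id : PolyTime fun a : α => a :=
  .of_runsIn .codeSize fun _ => .id

@[fun_prop]
theorem comp {g : β → γ} {f : α → β} (hg : PolyTime g) (hf : PolyTime f) :
    PolyTime fun a => g (f a) := by
  obtain ⟨P, s, hs, hP⟩ := hf.exists_runsIn
  obtain ⟨Q, p, hQ⟩ := hg
  exact .of_runsIn (by fun_prop) fun a => .comp (hP a) (hQ (f a))

@[fun_prop]
theorem fst {f : α → β × γ} (hf : PolyTime f) : PolyTime fun a => (f a).1 :=
  .comp (.of_runsIn (P := .hd) .codeSize fun _ => .hd) hf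

@[fun_prop]
theorem snd {f : α → β × γ} (hf : PolyTime f) : PolyTime fun a => (f a).2 :=
  .comp (.of_runsIn (P := .tl) .codeSize fun _ => .tl) hf

@[fun_prop]
theorem prodMk {f : α → β} {g : α → γ} (hf : PolyTime f) (hg : PolyTime g) :
    PolyTime fun a => (f a, g a) := by
  obtain ⟨P, s, hs, hP⟩ := hf.exists_runsIn
  obtain ⟨Q, t, ht, hQ⟩ := hg.exists_runsIn
  exact .of_runsIn (by fun_prop) fun a => .pair (hP a) (hQ a)

@[fun_prop]
theorem const (b : β) : PolyTime fun _ : α => b := by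
  suffices H : ∀ d : Data, ∃ P, ∃ t : α → ℕ, PolyBounded t ∧ ∀ a, RunsIn P (code a) (t a) d by
    obtain ⟨P, t, ht, h⟩ := H (code b)
    exact .of_runsIn ht h
  intro d
  induction d with
  | nil => exact ⟨.nil, _, .codeSize, fun _ => .nil⟩
  | cons x y hx hy =>
    obtain ⟨P, s, hs, hP⟩ := hx
    obtain ⟨Q, t, ht, hQ⟩ := hy
    exact ⟨.pair P Q, _, by fun_prop, fun a => .pair (hP a) (hQ a)⟩

theorem of_code_eq {δ : Type*} [DataEncoding δ] {f : α → β} {g : α → δ} (hf : PolyTime f)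
    (h : ∀ a, code (f a) = code (g a)) : PolyTime g :=
  let ⟨P, p, hP⟩ := hf
  ⟨P, p, fun a => h a ▸ hP a⟩

@[fun_prop]
theorem code_apply {f : α → β} (hf : PolyTime f) : PolyTime fun a => code (f a) :=
  hf.of_code_eq fun _ => rfl

@[fun_prop]
theorem listCons {f : α → β} {g : α → List β} (hf : PolyTime f) (hg : PolyTime g) :
    PolyTime fun a => f a :: g a :=
  (hf.prodMk hg).of_code_eq fun _ => rfl

@[fun_prop]
theorem decide_eq [DecidableEq β] {f g : α → β} (hf : PolyTime f) (hg : PolyTime g) :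
    PolyTime fun a => decide (f a = g a) := by
  suffices PolyTime fun z : β × β => decide (z.1 = z.2) from this.comp (hf.prodMk hg)
  refine .of_runsIn (P := .eq) .codeSize fun z => ?_
  convert! RunsIn.eq
  by_cases h : z.1 = z.2 <;>
    simp [Data.hd, Data.tl, h, code_injective.eq_iff, code]

@[fun_prop]
theorem ite {p : α → Prop} [DecidablePred p] {f g : α → β}
    (hp : PolyTime fun a => decide (p a)) (hf : PolyTime f) (hg : PolyTime g) :
    PolyTime fun a => if p a then f a else g a := by
  obtain ⟨P, r, hr, hP⟩ := hp.exists_runsIn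
  obtain ⟨Q, s, hs, hQ⟩ := hf.exists_runsIn
  obtain ⟨R, t, ht, hR⟩ := hg.exists_runsIn
  refine .of_runsIn (P := .ite P Q R) (t := fun a => codeSize a + r a + (s a + t a))
    (by fun_prop) fun a => ?_
  have hP := hP a
  by_cases h : p a
  · rw [if_pos h]
    rw [decide_eq_true h] at hP
    exact (RunsIn.ite_true hP (by simp [code, Data.tt]) (hQ a)).mono (by gcongr; lia)
  · rw [if_neg h]
    rw [decide_eq_false h] at hP
    exact (RunsIn.ite_false hP (hR a)).mono (by gcongr; lia)

section Decide

variable {p q : α → Prop} [DecidablePred p] [DecidablePred q]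

theorem decide_of_iff (hp : PolyTime fun a => decide (p a)) (h : ∀ a, p a ↔ q a) :
    PolyTime fun a => decide (q a) := by
  simpa only [h] using hp

@[fun_prop]
theorem decide_not (hp : PolyTime fun a => decide (p a)) : PolyTime fun a => decide (¬p a) := by
  have : PolyTime fun a => if p a then false else true := by fun_prop
  simpa using this

@[fun_prop]
theorem decide_and (hp : PolyTime fun a => decide (p a)) (hq : PolyTime fun a => decide (q a)) :
    PolyTime fun a => decide (p a ∧ q a) := by
  have : PolyTime fun a => if p a then decide (q a) else false := by fun_prop
  simpa using this

@[fun_prop]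
theorem decide_or (hp : PolyTime fun a => decide (p a)) (hq : PolyTime fun a => decide (q a)) :
    PolyTime fun a => decide (p a ∨ q a) := by
  have : PolyTime fun a => if p a then true else decide (q a) := by fun_prop
  simpa using this

end Decide

end PolyTime

/-- One pass of a loop that runs through a list: it turns the state `(c, a :: l, b)` into
`(c, l, b')`, where `P` computes `b'` from `(c, b, a)`. -/
def Prog.foldBody (P : Prog) : Prog :=
  .pair .hd (.pair (.comp .tl (.comp .hd .tl))
    (.comp (.pair .hd (.pair (.comp .tl .tl) (.comp .tl (.comp .hd .hd)))) P))

theorem RunsIn.foldBody {P : Prog} {c a l b y : Data} {n : ℕ}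
    (hP : RunsIn P (.cons c (.cons b a)) n y) :
    RunsIn P.foldBody (.cons c (.cons (.cons a l) b))
      (20 * (Data.cons c (.cons (.cons a l) b)).size + n) (.cons c (.cons l y)) := by
  refine (RunsIn.pair .hd (.pair (.comp .tl (.comp .hd .tl))
    (.comp (.pair .hd (.pair (.comp .tl .tl) (.comp .tl (.comp .hd .hd)))) hP))).mono ?_
  simp only [Data.size, Data.hd, Data.tl]
  lia

theorem RunsIn.foldLoop {P : Prog} {f : β → α → β} {c : γ} {s n : ℕ}
    (hP : ∀ b a, codeSize (c, b, a) ≤ s → RunsIn P (code (c, b, a)) n (code (f b a)))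
    {l : List α} {b : β} (hs : ∀ k, k <+: l → codeSize (c, l, k.foldl f b) ≤ s) :
    RunsIn (.loop (.comp .tl .hd) P.foldBody) (code (c, l, b)) ((l.length + 1) * (25 * s + n))
      (code (c, ([] : List α), l.foldl f b)) := by
  induction l generalizing b with
  | nil =>
    have hs := hs [] List.prefix_rfl
    simp only [codeSize_pair, codeSize_nil, List.foldl_nil] at hs
    refine (RunsIn.loop_halt (.comp .tl .hd)).mono ?_
    simp only [codeSize, code_pair, code_nil, Data.size, Data.tl, List.length_nil] at hs ⊢
    lia
  | cons a l ih =>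
    have hs₀ := hs [] List.nil_prefix
    have hba : codeSize (c, b, a) ≤ s := by
      simp only [codeSize_pair, codeSize_cons, List.foldl_nil] at hs₀ ⊢
      lia
    have hl : ∀ k, k <+: l → codeSize (c, l, k.foldl f (f b a)) ≤ s := by
      intro k hk
      have := hs (a :: k) (List.cons_prefix_cons.2 ⟨rfl, hk⟩)
      simp only [codeSize_pair, codeSize_cons, List.foldl_cons] at this ⊢
      lia
    refine (RunsIn.loop_again (.comp .tl .hd) (by simp [code, Data.hd, Data.tl])
      (hP b a hba).foldBody (ih hl)).mono ?_
    simp only [codeSize, code_pair, code_cons, Data.size, Data.tl, List.length_cons,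
      List.foldl_nil] at hs₀ ⊢
    lia

theorem RunsIn.fold {P : Prog} {f : β → α → β} {c : γ} {s n : ℕ}
    (hP : ∀ b a, codeSize (c, b, a) ≤ s → RunsIn P (code (c, b, a)) n (code (f b a)))
    {l : List α} {b : β} (hs : ∀ k, k <+: l → codeSize (c, l, k.foldl f b) ≤ s) :
    RunsIn (.comp (.loop (.comp .tl .hd) P.foldBody) (.comp .tl .tl)) (code (c, l, b))
      ((l.length + 2) * (25 * s + n)) (code (l.foldl f b)) := by
  have hstart := hs [] List.nil_prefix
  have hend := hs l List.prefix_rfl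
  have := length_lt_codeSize l
  refine (RunsIn.comp (.foldLoop hP hs) (.comp .tl .tl)).mono ?_
  simp only [codeSize, code_pair, code_nil, Data.size, Data.tl, List.foldl_nil]
    at hstart hend this ⊢
  lia

@[fun_prop]
theorem PolyBounded.length {l : γ → List α} (hl : PolyTime l) :
    PolyBounded fun c => (l c).length :=
  (PolyBounded.codeSize_apply hl).mono fun c => (length_lt_codeSize (l c)).le

namespace PolyTime

theorem foldl {f : γ → β → α → β} {l : γ → List α} {b : γ → β} (hl : PolyTime l)
    (hb : PolyTime b) (hf : PolyTime fun z : γ × β × α => f z.1 z.2.1 z.2.2) {t : γ → ℕ}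
    (ht : PolyBounded t) (hft : ∀ c k, k <+: l c → codeSize (k.foldl (f c) (b c)) ≤ t c) :
    PolyTime fun c => (l c).foldl (f c) (b c) := by
  obtain ⟨Q, q, hq, hQ⟩ := (id.prodMk (hl.prodMk hb)).exists_runsIn
  obtain ⟨P, p, hP⟩ := hf
  let s c := codeSize c + codeSize (l c) + t c + 2
  have hs : PolyBounded s := by unfold s; fun_prop
  have hstate c k (hk : k <+: l c) : codeSize (c, l c, k.foldl (f c) (b c)) ≤ s c := by
    have := hft c k hk
    simp only [codeSize_pair, s]
    lia
  exact .of_runsIn (by fun_prop) fun c => .comp (hQ c) <|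
    .fold (fun b a h => (hP (c, b, a)).mono (eval_mono p h)) (hstate c)

theorem foldl_of_le {f : γ → β → α → β} {l : γ → List α} {b : γ → β} (hl : PolyTime l)
    (hb : PolyTime b) (hf : PolyTime fun z : γ × β × α => f z.1 z.2.1 z.2.2)
    (hle : ∀ c x a, codeSize (f c x a) ≤ codeSize x) :
    PolyTime fun c => (l c).foldl (f c) (b c) := by
  refine foldl hl hb hf (.codeSize_apply hb) fun c k _ => ?_
  exact List.foldlRecOn k (f c) (motive := fun x => codeSize x ≤ codeSize (b c)) le_rfl
    fun x hx a _ => (hle c x a).trans hx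

theorem iterate_length {f : γ → β → β} {b : γ → β} {l : γ → List α}
    (hf : PolyTime fun z : γ × β => f z.1 z.2) (hl : PolyTime l) (hb : PolyTime b)
    {t : γ → ℕ} (ht : PolyBounded t) (hft : ∀ c n, codeSize ((f c)^[n] (b c)) ≤ t c) :
    PolyTime fun c => (f c)^[(l c).length] (b c) := by
  have := foldl (f := fun c x (_ : α) => f c x) hl hb (by fun_prop) ht fun c k _ => by
    simpa only [List.foldl_const] using hft c k.length
  simpa only [List.foldl_const] using this

@[fun_prop]
theorem reverse {l : γ → List α} (hl : PolyTime l) : PolyTime fun c => (l c).reverse := by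
  have := foldl (f := fun _ (k : List α) a => a :: k) (b := fun _ => []) hl (by fun_prop)
    (by fun_prop) (PolyBounded.codeSize_apply hl) fun c k hk => by
      rw [List.foldl_flip_cons_eq_append', List.append_nil, codeSize_reverse]
      exact codeSize_le_of_sublist hk.sublist
  simpa using this

@[fun_prop]
theorem append {k l : γ → List α} (hk : PolyTime k) (hl : PolyTime l) :
    PolyTime fun c => k c ++ l c := by
  have := foldl (f := fun _ (k : List α) a => a :: k) hk.reverse hl (by fun_prop)
    ((PolyBounded.codeSize_apply hk).add (.codeSize_apply hl)) fun c m hm => by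
      have := codeSize_append m.reverse (l c)
      have := codeSize_le_of_sublist hm.sublist
      simp only [codeSize_reverse] at *
      rw [List.foldl_flip_cons_eq_append']
      lia
  simpa using this

@[fun_prop]
theorem flatMap {f : γ → α → List β} {l : γ → List α} (hl : PolyTime l)
    (hf : PolyTime fun z : γ × α => f z.1 z.2) : PolyTime fun c => (l c).flatMap (f c) := by
  obtain ⟨p, hp⟩ := PolyBounded.codeSize_apply hf
  have := foldl (f := fun c k a => k ++ f c a) (b := fun _ => []) hl (by fun_prop) (by fun_prop)
    (t := fun c => (l c).length * p.eval (codeSize c + codeSize (l c)) + 1)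
    (by fun_prop) fun c k hk => by
      rw [← List.flatMap_eq_foldl]
      have h a (ha : a ∈ k) : codeSize (f c a) ≤ p.eval (codeSize c + codeSize (l c)) := by
        refine (hp (c, a)).trans (eval_mono p ?_)
        have := codeSize_lt_of_mem (hk.mem ha)
        rw [codeSize_pair]
        lia
      grw [codeSize_flatMap_le h, hk.length_le]
  simpa only [List.flatMap_eq_foldl] using this

@[fun_prop]
theorem map {f : γ → α → β} {l : γ → List α} (hl : PolyTime l)
    (hf : PolyTime fun z : γ × α => f z.1 z.2) : PolyTime fun c => (l c).map (f c) := by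
  simp only [List.map_eq_flatMap]
  fun_prop

@[fun_prop]
theorem product {k : γ → List α} {l : γ → List β} (hk : PolyTime k) (hl : PolyTime l) :
    PolyTime fun c => k c ×ˢ l c := by
  simp only [SProd.sprod, List.product]
  fun_prop

section Decide

variable {p : γ → α → Prop} [∀ c, DecidablePred (p c)] {l : γ → List α}

@[fun_prop]
theorem filter (hl : PolyTime l) (hp : PolyTime fun z : γ × α => decide (p z.1 z.2)) :
    PolyTime fun c => (l c).filter (p c ·) := by
  have : PolyTime fun c => (l c).flatMap fun a => if p c a then [a] else [] := by fun_prop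
  refine this.of_code_eq fun c => congrArg _ ?_
  induction l c with
  | nil => rfl
  | cons a l ih =>
    rw [List.filter_cons, List.flatMap_cons, ih]
    by_cases h : p c a <;> simp [h]

@[fun_prop]
theorem decide_exists_mem (hl : PolyTime l)
    (hp : PolyTime fun z : γ × α => decide (p z.1 z.2)) :
    PolyTime fun c => decide (∃ a ∈ l c, p c a) := by
  have : PolyTime fun c => decide (¬code ((l c).filter (p c ·)) = .nil) := by
    have := hl.filter hp
    fun_prop
  refine this.decide_of_iff fun c => ?_
  rw [← code_nil (α := α), code_injective.eq_iff]
  simp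

@[fun_prop]
theorem decide_forall_mem (hl : PolyTime l)
    (hp : PolyTime fun z : γ × α => decide (p z.1 z.2)) :
    PolyTime fun c => decide (∀ a ∈ l c, p c a) := by
  have : PolyTime fun c => decide (¬∃ a ∈ l c, ¬p c a) := by fun_prop
  exact this.decide_of_iff fun c => by simp only [not_exists, not_and, not_not]

@[fun_prop]
theorem decide_mem {f : γ → α} [∀ c, Decidable (f c ∈ l c)] (hf : PolyTime f)
    (hl : PolyTime l) : PolyTime fun c => decide (f c ∈ l c) := by
  classical
  have : PolyTime fun c => decide (∃ a ∈ l c, a = f c) := by fun_prop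
  exact this.decide_of_iff fun c => by simp only [exists_eq_right]

end Decide

end PolyTime

end PolyTime

/-! ### The pruning algorithm on lists -/

/-- Graphs given by lists of their symbols, nodes and edges, for computation. -/
structure GraphList (L : Type u) (N : Type v) where
  symbols : List L
  nodes : List N
  edges : List (N × L × N)

/-- Guests given by lists, for computation. The choice function is the list of its values, paired
with their arguments. -/
structure GuestList (L : Type u) (N : Type v) where
  graph : GraphList L N
  must : List N
  unique : List N
  exclusive : List N
  choice : List (N × List (List (N × L × N)))

section Encoding

variable {L : Type u} {N : Type v} [DataEncoding L] [DataEncoding N]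

instance : DataEncoding (GraphList L N) where
  code S := code (S.symbols, S.nodes, S.edges)
  code_injective := by
    rintro ⟨_, _, _⟩ ⟨_, _, _⟩ h
    simpa using code_injective h

instance : DataEncoding (GuestList L N) where
  code G := code (G.graph, G.must, G.unique, G.exclusive, G.choice)
  code_injective := by
    rintro ⟨_, _, _, _, _⟩ ⟨_, _, _, _, _⟩ h
    simpa using code_injective h

theorem GraphList.codeSize_le {S T : GraphList L N} (hs : codeSize S.symbols ≤ codeSize T.symbols)
    (hn : codeSize S.nodes ≤ codeSize T.nodes) (he : codeSize S.edges ≤ codeSize T.edges) :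
    codeSize S ≤ codeSize T := by
  change codeSize (S.symbols, S.nodes, S.edges) ≤ codeSize (T.symbols, T.nodes, T.edges)
  simp only [codeSize_pair]
  lia

namespace PolyTime

variable {α : Type w} [DataEncoding α] {S : α → GraphList L N} {G : α → GuestList L N}

theorem graphList_toProd (hS : PolyTime S) :
    PolyTime fun a => ((S a).symbols, (S a).nodes, (S a).edges) :=
  hS.of_code_eq fun _ => rfl

@[fun_prop]
theorem graphList_symbols (hS : PolyTime S) : PolyTime fun a => (S a).symbols :=
  hS.graphList_toProd.fst

@[fun_prop]
theorem graphList_nodes (hS : PolyTime S) : PolyTime fun a => (S a).nodes :=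
  hS.graphList_toProd.snd.fst

@[fun_prop]
theorem graphList_edges (hS : PolyTime S) : PolyTime fun a => (S a).edges :=
  hS.graphList_toProd.snd.snd

@[fun_prop]
theorem graphList_mk {σ : α → List L} {V : α → List N} {E : α → List (N × L × N)}
    (hσ : PolyTime σ) (hV : PolyTime V) (hE : PolyTime E) :
    PolyTime fun a => GraphList.mk (σ a) (V a) (E a) :=
  (hσ.prodMk (hV.prodMk hE)).of_code_eq fun _ => rfl

theorem guestList_toProd (hG : PolyTime G) :
    PolyTime fun a => ((G a).graph, (G a).must, (G a).unique, (G a).exclusive, (G a).choice) :=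
  hG.of_code_eq fun _ => rfl

@[fun_prop]
theorem guestList_graph (hG : PolyTime G) : PolyTime fun a => (G a).graph :=
  hG.guestList_toProd.fst

@[fun_prop]
theorem guestList_must (hG : PolyTime G) : PolyTime fun a => (G a).must :=
  hG.guestList_toProd.snd.fst

@[fun_prop]
theorem guestList_choice (hG : PolyTime G) : PolyTime fun a => (G a).choice :=
  hG.guestList_toProd.snd.snd.snd.snd

end PolyTime

end Encoding

namespace GraphList

variable {L : Type u} {N : Type v} {N' : Type w} [DecidableEq N] [DecidableEq N']

/-- The edges that leave `x` or continue an edge of `R`: one step of the search for the edges that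
are reachable from `x`. -/
def searchStep (S : GraphList L N) (x : N) (R : List (N × L × N)) : List (N × L × N) :=
  S.edges.filter fun e => e.1 = x ∨ ∃ f ∈ R, f.2.2 = e.1

/-- The edges on walks that start in `x`. The search saturates within `S.edges.length` steps since
each step before that adds an edge. -/
def edgesFrom (S : GraphList L N) (x : N) : List (N × L × N) :=
  (S.searchStep x)^[S.edges.length] []

/-- `y` is reached from `x` by a nonempty path. -/
def Reaches (S : GraphList L N) (x y : N) : Prop :=
  ∃ e ∈ S.edgesFrom x, e.2.2 = y

instance (S : GraphList L N) (x y : N) : Decidable (S.Reaches x y) :=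
  inferInstanceAs (Decidable (∃ e ∈ S.edgesFrom x, e.2.2 = y))

/-- Every edge in `γ` is matched by an edge of `S` with source `x`. -/
def Realizes [DecidableEq L] (S : GraphList L (N × N')) (x : N × N') (γ : List (N × L × N)) :
    Prop :=
  ∀ g ∈ γ, ∃ f ∈ S.edges, (f.1, f.2.1, f.2.2.1) = (x, g.2)

instance [DecidableEq L] (S : GraphList L (N × N')) (x : N × N') (γ : List (N × L × N)) :
    Decidable (S.Realizes x γ) :=
  inferInstanceAs (Decidable (∀ g ∈ γ, ∃ f ∈ S.edges, (f.1, f.2.1, f.2.2.1) = (x, g.2)))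

/-- `HostGraph.removeEdge` on lists. -/
def removeEdge [DecidableEq L] (S : GraphList L N) (e : N × L × N) : GraphList L N :=
  ⟨S.symbols, S.nodes, S.edges.filter fun f => f ≠ e⟩

/-- `HostGraph.removeNode` on lists. -/
def removeNode (S : GraphList L N) (x : N) : GraphList L N :=
  ⟨S.symbols, S.nodes.filter fun y => y ≠ x, S.edges.filter fun e => ¬(e.1 = x ∨ e.2.2 = x)⟩

/-- `HostGraph.prod` on lists. -/
def prod [DecidableEq L] (S : GraphList L N) (T : GraphList L N') : GraphList L (N × N') where
  symbols := S.symbols.filter fun a => a ∈ T.symbols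
  nodes := S.nodes ×ˢ T.nodes
  edges := ((S.edges ×ˢ T.edges).filter fun p => p.1.2.1 = p.2.2.1).map
    fun p => ((p.1.1, p.2.1), p.1.2.1, (p.1.2.2, p.2.2.2))

end GraphList

namespace GuestList

variable {L : Type u} {N : Type v} {N' : Type w} [DecidableEq L] [DecidableEq N] [DecidableEq N']

/-- `EdgeSupported` on lists. -/
def SupportsEdge (G : GuestList L N) (S : GraphList L (N × N')) (e : (N × N') × L × (N × N')) :
    Prop :=
  ∃ c ∈ G.choice, c.1 = e.1.1 ∧ ∃ γ ∈ c.2, (e.1.1, e.2.1, e.2.2.1) ∈ γ ∧ S.Realizes e.1 γ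

instance (G : GuestList L N) (S : GraphList L (N × N')) (e : (N × N') × L × (N × N')) :
    Decidable (G.SupportsEdge S e) := by
  unfold SupportsEdge
  infer_instance

/-- `NodeRefuted` on lists. -/
def RefutesNode (G : GuestList L N) (S : GraphList L (N × N')) (x : N × N') : Prop :=
  ((∀ e ∈ S.edges, ¬e.1 = x) ∧ ∀ c ∈ G.choice, ¬(c.1 = x.1 ∧ [] ∈ c.2)) ∨
    ∃ m ∈ G.must, G.graph.Reaches x.1 m ∧ ∀ y ∈ S.nodes, ¬(y.1 = m ∧ S.Reaches x y)

instance (G : GuestList L N) (S : GraphList L (N × N')) (x : N × N') :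
    Decidable (G.RefutesNode S x) := by
  unfold RefutesNode
  infer_instance

/-- `LooseSim.pruneEdges` on lists. -/
def pruneEdges (G : GuestList L N) (S : GraphList L (N × N')) (x : N × N') :
    GraphList L (N × N') :=
  (S.edges.filter fun e => e.1 = x).foldl
    (fun S e => if G.SupportsEdge S e then S else S.removeEdge e) S

/-- `LooseSim.pruneNode` on lists. -/
def pruneNode (G : GuestList L N) (S : GraphList L (N × N')) (x : N × N') :
    GraphList L (N × N') :=
  if G.RefutesNode S x then S.removeNode x else S

/-- `LooseSim.pruneRound` on lists. -/
def pruneRound (G : GuestList L N) (S : GraphList L (N × N')) : GraphList L (N × N') :=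
  S.nodes.foldl (fun S x => G.pruneNode (G.pruneEdges S x) x) S

/-- The graph that the pruning algorithm is left with. Instead of testing whether a round changes
something, this executes as many rounds as can ever be necessary. -/
def prune (G : GuestList L N) (H : GraphList L N') : GraphList L (N × N') :=
  G.pruneRound^[(G.graph.prod H).nodes.length + (G.graph.prod H).edges.length] (G.graph.prod H)

/-- The test of `pruneReturn` on lists. -/
def MustOccurs (G : GuestList L N) (S : GraphList L (N × N')) : Prop :=
  ∀ m ∈ G.must, ∃ x ∈ S.nodes, x.1 = m

instance (G : GuestList L N) (S : GraphList L (N × N')) : Decidable (G.MustOccurs S) := by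
  unfold MustOccurs
  infer_instance

end GuestList

section PolyTime

variable {L : Type u} {N : Type v} {N' : Type w} [DecidableEq N] [DataEncoding L]
  [DataEncoding N] [DataEncoding N']

namespace GraphList

theorem codeSize_iterate_searchStep_le (S : GraphList L N) (x : N) (n : ℕ) :
    codeSize ((S.searchStep x)^[n] []) ≤ codeSize S.edges := by
  cases n with
  | zero => exact codeSize_le_of_sublist (List.nil_sublist _)
  | succ n =>
    rw [Function.iterate_succ_apply']
    exact codeSize_filter_le _ _

theorem codeSize_removeEdge_le [DecidableEq L] (S : GraphList L N) (e : N × L × N) :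
    codeSize (S.removeEdge e) ≤ codeSize S :=
  codeSize_le le_rfl le_rfl (codeSize_filter_le _ _)

theorem codeSize_removeNode_le (S : GraphList L N) (x : N) :
    codeSize (S.removeNode x) ≤ codeSize S :=
  codeSize_le le_rfl (codeSize_filter_le _ _) (codeSize_filter_le _ _)

end GraphList

namespace GuestList

variable [DecidableEq L] [DecidableEq N'] (G : GuestList L N) (S : GraphList L (N × N'))

theorem codeSize_pruneEdges_le (x : N × N') : codeSize (G.pruneEdges S x) ≤ codeSize S := by
  refine List.foldlRecOn _ _ (motive := fun T => codeSize T ≤ codeSize S) le_rfl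
    fun T hT e _ => ?_
  split_ifs
  exacts [hT, (T.codeSize_removeEdge_le e).trans hT]

theorem codeSize_pruneNode_le (x : N × N') : codeSize (G.pruneNode S x) ≤ codeSize S := by
  rw [pruneNode]
  split_ifs
  exacts [S.codeSize_removeNode_le x, le_rfl]

theorem codeSize_pruneRound_le : codeSize (G.pruneRound S) ≤ codeSize S :=
  List.foldlRecOn _ _ (motive := fun T => codeSize T ≤ codeSize S) le_rfl fun T hT x _ =>
    ((G.codeSize_pruneNode_le _ x).trans (G.codeSize_pruneEdges_le T x)).trans hT

theorem codeSize_iterate_pruneRound_le (n : ℕ) : codeSize (G.pruneRound^[n] S) ≤ codeSize S := by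
  induction n with
  | zero => exact le_rfl
  | succ n ih =>
    rw [Function.iterate_succ_apply']
    exact (G.codeSize_pruneRound_le _).trans ih

end GuestList

namespace PolyTime

variable {α : Type*} [DataEncoding α]

section GraphList

variable {S : α → GraphList L N} {x : α → N}

@[fun_prop]
theorem graphList_prod {L : Type u} {N : Type v} {N' : Type w} [DecidableEq L] [DataEncoding L]
    [DataEncoding N] [DataEncoding N'] {S : α → GraphList L N} {T : α → GraphList L N'}
    (hS : PolyTime S) (hT : PolyTime T) : PolyTime fun a => (S a).prod (T a) := by
  unfold GraphList.prod
  fun_prop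

@[fun_prop]
theorem searchStep {R : α → List (N × L × N)} (hS : PolyTime S) (hx : PolyTime x)
    (hR : PolyTime R) : PolyTime fun a => (S a).searchStep (x a) (R a) := by
  unfold GraphList.searchStep
  fun_prop

@[fun_prop]
theorem edgesFrom (hS : PolyTime S) (hx : PolyTime x) :
    PolyTime fun a => (S a).edgesFrom (x a) :=
  iterate_length (by fun_prop) hS.graphList_edges (const _)
    (.codeSize_apply hS.graphList_edges) fun _ _ => GraphList.codeSize_iterate_searchStep_le _ _ _

@[fun_prop]
theorem removeEdge [DecidableEq L] {e : α → N × L × N} (hS : PolyTime S) (he : PolyTime e) :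
    PolyTime fun a => (S a).removeEdge (e a) := by
  unfold GraphList.removeEdge
  fun_prop

@[fun_prop]
theorem removeNode (hS : PolyTime S) (hx : PolyTime x) :
    PolyTime fun a => (S a).removeNode (x a) := by
  unfold GraphList.removeNode
  fun_prop

end GraphList

section GuestList

variable [DecidableEq L] [DecidableEq N'] {G : α → GuestList L N} {S : α → GraphList L (N × N')}
  {x : α → N × N'}

@[fun_prop]
theorem refutesNode (hG : PolyTime G) (hS : PolyTime S) (hx : PolyTime x) :
    PolyTime fun a => decide ((G a).RefutesNode (S a) (x a)) := by
  have : PolyTime fun a => decide (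
      ((∀ e ∈ (S a).edges, ¬e.1 = x a) ∧ ∀ c ∈ (G a).choice, ¬(c.1 = (x a).1 ∧ [] ∈ c.2)) ∨
        ∃ m ∈ (G a).must, (G a).graph.Reaches (x a).1 m ∧
          ∀ y ∈ (S a).nodes, ¬(y.1 = m ∧ (S a).Reaches (x a) y)) := by
    fun_prop
  exact this

@[fun_prop]
theorem pruneEdges (hG : PolyTime G) (hS : PolyTime S) (hx : PolyTime x) :
    PolyTime fun a => (G a).pruneEdges (S a) (x a) := by
  refine foldl_of_le (by fun_prop) hS (f := fun a S e =>
    if (G a).SupportsEdge S e then S else S.removeEdge e) (by fun_prop) fun a S e => ?_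
  split_ifs
  exacts [le_rfl, S.codeSize_removeEdge_le e]

@[fun_prop]
theorem pruneNode (hG : PolyTime G) (hS : PolyTime S) (hx : PolyTime x) :
    PolyTime fun a => (G a).pruneNode (S a) (x a) := by
  unfold GuestList.pruneNode
  fun_prop

@[fun_prop]
theorem pruneRound (hG : PolyTime G) (hS : PolyTime S) :
    PolyTime fun a => (G a).pruneRound (S a) :=
  foldl_of_le (f := fun a S x => (G a).pruneNode ((G a).pruneEdges S x) x) hS.graphList_nodes hS
    (by fun_prop) fun a S x =>
      ((G a).codeSize_pruneNode_le _ x).trans ((G a).codeSize_pruneEdges_le S x)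

@[fun_prop]
theorem prune {H : α → GraphList L N'} (hG : PolyTime G) (hH : PolyTime H) :
    PolyTime fun a => (G a).prune (H a) := by
  have hP : PolyTime fun a => (G a).graph.prod (H a) := by fun_prop
  simp only [GuestList.prune, Function.iterate_add_apply]
  exact iterate_length (by fun_prop) hP.graphList_nodes
    (iterate_length (by fun_prop) hP.graphList_edges hP (.codeSize_apply hP)
      fun a n => (G a).codeSize_iterate_pruneRound_le _ n) (.codeSize_apply hP) fun a n => by
        rw [← Function.iterate_add_apply]
        exact (G a).codeSize_iterate_pruneRound_le _ _

end GuestList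

end PolyTime

end PolyTime

/-! ### Correctness of the algorithm on lists -/

/-- The arcs of a graph without their labels. Nonempty paths generate its transitive closure. -/
def HostGraph.Adj {L : Type u} {N : Type v} (M : HostGraph L N) (x y : N) : Prop :=
  ∃ e ∈ M.edges, e.1 = x ∧ e.2.2 = y

namespace HostGraph

variable {L : Type u} {N : Type v} {M : HostGraph L N} {x y : N}

theorem transGen_adj_of_mem_paths {p : List (N × L × N)} (hp : p ∈ M.paths x y) :
    Relation.TransGen M.Adj x y := by
  obtain ⟨hmem, hchain, ⟨e, he, rfl⟩, hlast⟩ := hp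
  induction p generalizing e with
  | nil => simp at he
  | cons f p ih =>
    obtain rfl : f = e := by simpa using he
    rw [List.forall_mem_cons] at hmem
    cases p with
    | nil => exact .single ⟨f, hmem.1, rfl, by simpa using hlast⟩
    | cons g p =>
      rw [List.isChain_cons_cons] at hchain
      exact .head ⟨f, hmem.1, rfl, hchain.1.symm⟩ (ih hmem.2 hchain.2 hlast g rfl)

theorem paths_nonempty_iff_transGen_adj :
    (M.paths x y).Nonempty ↔ Relation.TransGen M.Adj x y := by
  refine ⟨fun ⟨_, hp⟩ => transGen_adj_of_mem_paths hp, fun h => ?_⟩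
  induction h using Relation.TransGen.head_induction_on with
  | single h =>
    obtain ⟨e, he, rfl, rfl⟩ := h
    exact ⟨[e], List.forall_mem_singleton.2 he, .singleton e, ⟨e, rfl, rfl⟩, ⟨e, rfl, rfl⟩⟩
  | head h _ ih =>
    obtain ⟨e, he, rfl, htgt⟩ := h
    obtain ⟨p, hmem, hchain, ⟨f, hf, hsrc⟩, hlast⟩ := ih
    obtain ⟨p, rfl⟩ := List.head?_eq_some_iff.1 hf
    exact ⟨e :: f :: p, List.forall_mem_cons.2 ⟨he, hmem⟩,
      List.isChain_cons_cons.2 ⟨hsrc.trans htgt.symm, hchain⟩, ⟨e, rfl, rfl⟩, hlast⟩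

theorem mem_nodes_of_paths_nonempty (h : (M.paths x y).Nonempty) : y ∈ M.nodes := by
  obtain ⟨z, -, e, he, -, rfl⟩ := (Relation.TransGen.tail'_iff).1
    (paths_nonempty_iff_transGen_adj.1 h)
  exact M.tgt_mem e he

end HostGraph

section Search

variable {L : Type u} {N : Type v} [DecidableEq N] (S : GraphList L N) (x : N)

namespace GraphList

theorem iterate_searchStep_sublist_succ (n : ℕ) :
    ((S.searchStep x)^[n] []).Sublist ((S.searchStep x)^[n + 1] []) := by
  induction n with
  | zero => exact List.nil_sublist _
  | succ n ih =>
    rw [Function.iterate_succ_apply', Function.iterate_succ_apply' _ (n + 1)]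
    refine List.monotone_filter_right _ fun e he => ?_
    simp only [decide_eq_true_eq] at he ⊢
    exact he.imp_right fun ⟨f, hf, hfe⟩ => ⟨f, ih.subset hf, hfe⟩

theorem searchStep_edgesFrom : S.searchStep x (S.edgesFrom x) = S.edgesFrom x := by
  let R n := (S.searchStep x)^[n] []
  have hR n : (R n).Sublist (R (n + 1)) := S.iterate_searchStep_sublist_succ x n
  have hsucc n : R (n + 1) = S.searchStep x (R n) := Function.iterate_succ_apply' _ _ _
  have hbound n : (R n).length ≤ S.edges.length := by
    cases n with
    | zero => exact Nat.zero_le _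
    | succ n => exact hsucc n ▸ List.length_filter_le _ _
  have hlen : (R (S.edges.length + 1)).length = (R S.edges.length).length :=
    Nat.stabilises_of_monotone (monotone_nat_of_le_succ fun n => (hR n).length_le) hbound
      (fun n hn => by rwa [hsucc (n + 1), ← (hR n).eq_of_length hn, ← hsucc])
      (Nat.le_succ _)
  exact (hsucc _).symm.trans ((hR _).eq_of_length hlen.symm).symm

variable {S x} {M : HostGraph L N}

theorem reaches_iff_paths_nonempty (hS : ∀ e, e ∈ S.edges ↔ e ∈ M.edges) {y : N} :
    S.Reaches x y ↔ (M.paths x y).Nonempty := by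
  rw [HostGraph.paths_nonempty_iff_transGen_adj]
  constructor
  · have hsound n : ∀ e ∈ (S.searchStep x)^[n] [], Relation.TransGen M.Adj x e.2.2 := by
      induction n with
      | zero => simp
      | succ n ih =>
        intro e he
        simp only [Function.iterate_succ_apply', searchStep, List.mem_filter,
          decide_eq_true_eq] at he
        have hadj : M.Adj e.1 e.2.2 := ⟨e, (hS e).1 he.1, rfl, rfl⟩
        obtain rfl | ⟨f, hf, hfe⟩ := he.2
        · exact .single hadj
        · exact .tail (ih f hf) (hfe ▸ hadj)
    rintro ⟨e, he, rfl⟩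
    exact hsound _ e he
  · intro h
    have hclosed {e} (he : e ∈ M.edges) (hx : e.1 = x ∨ S.Reaches x e.1) : S.Reaches x e.2.2 := by
      refine ⟨e, ?_, rfl⟩
      rw [← searchStep_edgesFrom]
      exact List.mem_filter.2 ⟨(hS e).2 he, decide_eq_true hx⟩
    induction h with
    | single h =>
      obtain ⟨e, he, hx, rfl⟩ := h
      exact hclosed he (.inl hx)
    | tail _ h ih =>
      obtain ⟨e, he, rfl, rfl⟩ := h
      exact hclosed he (.inr ih)

end GraphList

end Search

section Lists

/-- `l` lists the elements of `s` without repetition. -/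
def Lists {α : Type u} (l : List α) (s : Finset α) : Prop :=
  l.Nodup ∧ ∀ a, a ∈ l ↔ a ∈ s

theorem Lists.length_eq_card {α : Type u} {l : List α} {s : Finset α} (h : Lists l s) :
    l.length = s.card := by
  classical
  rw [← List.toFinset_card_of_nodup h.1]
  congr 1
  ext a
  rw [List.mem_toFinset, h.2]

theorem Lists.filter_self {α : Type u} {l : List α} {s : Finset α} [DecidableEq α]
    (h : Lists l s) : l.filter (· ∈ s) = l :=
  List.filter_eq_self.2 fun a ha => decide_eq_true ((h.2 a).1 ha)

theorem Lists.filter {α : Type u} {l : List α} {s t : Finset α} [DecidableEq α]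
    (h : Lists l s) (hts : t ⊆ s) : Lists (l.filter (· ∈ t)) t :=
  ⟨h.1.filter _, fun a => by simpa [h.2] using @hts a⟩

open scoped Classical in
/-- The enumeration that follows the order of the list `l` on finite sets of members of `l`. It
commutes with the removal of elements, and therefore makes the loops of the pruning algorithm run
through the lists that represent the current graph. -/
noncomputable def enumerationOfList {α : Type u} {l : List α} (hl : l.Nodup) : Enumeration α where
  toList s := if ∀ a ∈ s, a ∈ l then l.filter (· ∈ s) else s.toList
  nodup s := by
    split_ifs
    exacts [hl.filter _, s.nodup_toList]
  mem_iff s a := by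
    split_ifs with h
    · simpa using h a
    · exact Finset.mem_toList

theorem enumerationOfList_toList {α : Type u} {l : List α} [DecidableEq α] (hl : l.Nodup)
    {s : Finset α} (hs : ∀ a ∈ s, a ∈ l) :
    (enumerationOfList hl).toList s = l.filter (· ∈ s) := by
  simp only [enumerationOfList, if_pos hs]
  congr!

namespace GraphList

variable {L : Type u} {N : Type v} {N' : Type w}

/-- `S` lists the symbols, nodes and edges of `M`. -/
structure Represents (S : GraphList L N) (M : HostGraph L N) : Prop where
  symbols : Lists S.symbols M.symbols
  nodes : Lists S.nodes M.nodes
  edges : Lists S.edges M.edges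

/-- The part of `S` that belongs to the graph `T`, in the order of `S`. -/
def restrict [DecidableEq L] [DecidableEq N] (S : GraphList L N) (T : HostGraph L N) :
    GraphList L N :=
  ⟨S.symbols.filter (· ∈ T.symbols), S.nodes.filter (· ∈ T.nodes), S.edges.filter (· ∈ T.edges)⟩

variable [DecidableEq L] [DecidableEq N]

theorem Represents.prod [DecidableEq N'] {S : GraphList L N} {S' : GraphList L N'}
    {M : HostGraph L N} {M' : HostGraph L N'} (hS : S.Represents M) (hS' : S'.Represents M') :
    (S.prod S').Represents (M.prod M') where
  symbols := ⟨hS.symbols.1.filter _, fun a => by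
    simp [GraphList.prod, HostGraph.prod, hS.symbols.2, hS'.symbols.2]⟩
  nodes := ⟨hS.nodes.1.product hS'.nodes.1, fun ⟨_, _⟩ => by
    simp [GraphList.prod, HostGraph.prod, hS.nodes.2, hS'.nodes.2]⟩
  edges := by
    refine ⟨List.Nodup.map_on ?_ ((hS.edges.1.product hS'.edges.1).filter _), fun a => ?_⟩
    · simp +contextual [Prod.ext_iff]
    · simp [GraphList.prod, HostGraph.prod, hS.edges.2, hS'.edges.2]

variable {S : GraphList L N} {M T : HostGraph L N}

theorem Represents.restrict (hS : S.Represents M) (hT : T ≤ M) : (S.restrict T).Represents T :=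
  ⟨hS.symbols.filter hT.1, hS.nodes.filter hT.2.1, hS.edges.filter hT.2.2⟩

theorem Represents.restrict_self (hS : S.Represents M) : S.restrict M = S := by
  rw [GraphList.restrict, hS.symbols.filter_self, hS.nodes.filter_self, hS.edges.filter_self]

theorem restrict_removeEdge (S : GraphList L N) (T : HostGraph L N) (e : N × L × N) :
    S.restrict (T.removeEdge e) = (S.restrict T).removeEdge e := by
  have h : S.edges.filter (· ∈ T.edges.erase e) =
      (S.edges.filter (· ∈ T.edges)).filter (· ≠ e) := by
    simp [List.filter_filter]
  exact congrArg (GraphList.mk _ _) h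

theorem restrict_removeNode (S : GraphList L N) (T : HostGraph L N) (x : N) :
    S.restrict (T.removeNode x) = (S.restrict T).removeNode x := by
  have hV : S.nodes.filter (· ∈ T.nodes.erase x) =
      (S.nodes.filter (· ∈ T.nodes)).filter (· ≠ x) := by
    simp [List.filter_filter]
  have hE : S.edges.filter (· ∈ T.edges.filter fun e => ¬(e.1 = x ∨ e.2.2 = x)) =
      (S.edges.filter (· ∈ T.edges)).filter fun e => ¬(e.1 = x ∨ e.2.2 = x) := by
    simp [List.filter_filter, and_comm]
  exact congrArg₂ (GraphList.mk _) hV hE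

end GraphList

end Lists

/-- `g` lists the data of the guest `G` that the pruning algorithm uses, where the choice sets of
a node may be distributed over several entries. -/
structure GuestList.Represents {L : Type u} {N : Type v} [DecidableEq L] [DecidableEq N]
    (g : GuestList L N) (G : Guest L N) : Prop where
  graph : g.graph.Represents G.toHostGraph
  must : ∀ m, m ∈ g.must ↔ m ∈ G.must
  choice : ∀ x ∈ G.nodes, ∀ γ,
    γ ∈ G.choice x ↔ ∃ c ∈ g.choice, c.1 = x ∧ ∃ k ∈ c.2, k.toFinset = γ

theorem Guest.fst_eq_of_mem_choice {L : Type u} {N : Type v} (G : Guest L N) {u : N}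
    (hu : u ∈ G.nodes) {γ : Finset (N × L × N)} (hγ : γ ∈ G.choice u) {e : N × L × N}
    (he : e ∈ γ) : e.1 = u :=
  ((G.choice_union u hu e).1 ⟨γ, hγ, he⟩).2

section Correctness

variable {L : Type u} {N : Type v} {N' : Type w} [DecidableEq L] [DecidableEq N] [DecidableEq N']
  {G : Guest L N} {H : HostGraph L N'} {g : GuestList L N} {h : GraphList L N'}
  {S : GraphList L (N × N')} {T M : HostGraph L (N × N')} {x : N × N'}

theorem GraphList.realizes_iff (hS : S.Represents T) (hT : T ≤ G.toHostGraph.prod H)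
    {k : List (N × L × N)} (hk : ∀ e ∈ k, e.1 = x.1) :
    S.Realizes x k ↔ ∀ (b : L) (v : N), (x.1, b, v) ∈ k →
      ∃ v' : N', (x.2, b, v') ∈ H.out x.2 ∧ (x, b, (v, v')) ∈ T.out x := by
  have hout (b : L) (v : N) (v' : N') (he : (x, b, (v, v')) ∈ T.edges) :
      (x.2, b, v') ∈ H.out x.2 :=
    HostGraph.mem_out.2 ⟨(HostGraph.mem_prod_edges.1 (hT.2.2 he)).2, rfl⟩
  constructor
  · intro hreal b v hbv
    obtain ⟨⟨y, b', v₁, v'⟩, hf, heq⟩ := hreal _ hbv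
    obtain ⟨rfl, rfl, rfl⟩ : y = x ∧ b' = b ∧ v₁ = v := by simpa using heq
    have he := (hS.edges.2 _).1 hf
    exact ⟨v', hout _ _ _ he, HostGraph.mem_out.2 ⟨he, rfl⟩⟩
  · rintro hreal ⟨u, b, v⟩ hbv
    obtain rfl : u = x.1 := hk _ hbv
    obtain ⟨v', -, he⟩ := hreal b v hbv
    exact ⟨_, (hS.edges.2 _).2 (HostGraph.mem_out.1 he).1, rfl⟩

namespace GuestList

theorem supportsEdge_iff (hg : g.Represents G) (hS : S.Represents T)
    (hT : T ≤ G.toHostGraph.prod H) {e : (N × N') × L × (N × N')} (he : e.1.1 ∈ G.nodes) :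
    g.SupportsEdge S e ↔ EdgeSupported G H T e := by
  have hmem := hg.choice _ he
  constructor
  · rintro ⟨c, hc, hce, k, hk, hek, hreal⟩
    have hγ := (hmem k.toFinset).2 ⟨c, hc, hce, k, hk, rfl⟩
    rw [GraphList.realizes_iff hS hT fun f hf =>
      G.fst_eq_of_mem_choice he hγ (List.mem_toFinset.2 hf)] at hreal
    exact ⟨_, hγ, List.mem_toFinset.2 hek, fun b v hbv => hreal b v (List.mem_toFinset.1 hbv)⟩
  · rintro ⟨γ, hγ, heγ, hreal⟩
    obtain ⟨c, hc, hce, k, hk, rfl⟩ := (hmem γ).1 hγ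
    simp only [List.mem_toFinset] at heγ hreal
    exact ⟨c, hc, hce, k, hk, heγ, (GraphList.realizes_iff hS hT fun f hf =>
      G.fst_eq_of_mem_choice he hγ (List.mem_toFinset.2 hf)).2 hreal⟩

theorem refutesNode_iff (hg : g.Represents G) (hS : S.Represents T)
    (hT : T ≤ G.toHostGraph.prod H) (hx : x.1 ∈ G.nodes) :
    g.RefutesNode S x ↔ NodeRefuted G H T x := by
  have hout : (∀ e ∈ S.edges, ¬e.1 = x) ↔ T.out x = ∅ := by
    simp only [HostGraph.out, Finset.filter_eq_empty_iff, hS.edges.2]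
  have hchoice : (∀ c ∈ g.choice, ¬(c.1 = x.1 ∧ [] ∈ c.2)) ↔ ∅ ∉ G.choice x.1 := by
    simp only [hg.choice _ hx, List.toFinset_eq_empty_iff, exists_eq_right, not_exists, not_and]
  have hreach (m : N) : (∀ y ∈ S.nodes, ¬(y.1 = m ∧ S.Reaches x y)) ↔
      ∀ v' ∈ H.nodes, T.paths x (m, v') = ∅ := by
    simp only [GraphList.reaches_iff_paths_nonempty hS.edges.2, hS.nodes.2,
      ← Set.not_nonempty_iff_eq_empty]
    constructor
    · exact fun hnone v' _ hp => hnone _ (HostGraph.mem_nodes_of_paths_nonempty hp) ⟨rfl, hp⟩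
    · rintro hnone ⟨v, v'⟩ hv ⟨rfl, hp⟩
      exact hnone v' (Finset.mem_product.1 (hT.2.1 hv)).2 hp
  simp only [RefutesNode, NodeRefuted, hout, hchoice, hreach, hg.must,
    GraphList.reaches_iff_paths_nonempty hg.graph.edges.2]

theorem pruneEdges_restrict (hg : g.Represents G) (hS : S.Represents M)
    (hM : M ≤ G.toHostGraph.prod H) (hT : T ≤ M) (hx : x.1 ∈ G.nodes) :
    g.pruneEdges (S.restrict T) x =
      S.restrict (LooseSim.pruneEdges G H (enumerationOfList hS.edges.1) T x) := by
  have hlist : (S.restrict T).edges.filter (fun e => e.1 = x) =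
      (enumerationOfList hS.edges.1).toList (T.out x) := by
    rw [enumerationOfList_toList _ fun e he =>
      (hS.edges.2 e).2 (hT.2.2 (HostGraph.mem_out.1 he).1)]
    simp [GraphList.restrict, HostGraph.mem_out, List.filter_filter, and_comm]
  rw [GuestList.pruneEdges, hlist, LooseSim.pruneEdges]
  refine foldl_comm_of_le (ite_edgeSupported_le G H) fun T' hT' e he => ?_
  have hT'M := hT'.trans hT
  have hex := (HostGraph.mem_out.1 ((Enumeration.mem_iff _ _ _).1 he)).2
  have hsupp := supportsEdge_iff hg (hS.restrict hT'M) (hT'M.trans hM) (hex ▸ hx)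
  split_ifs with h₁ h₂ h₂
  · rfl
  · exact absurd (hsupp.1 h₁) h₂
  · exact absurd (hsupp.2 h₂) h₁
  · exact (S.restrict_removeEdge T' e).symm

theorem pruneNode_restrict (hg : g.Represents G) (hS : S.Represents M)
    (hM : M ≤ G.toHostGraph.prod H) (hT : T ≤ M) (hx : x.1 ∈ G.nodes) :
    g.pruneNode (S.restrict T) x = S.restrict (LooseSim.pruneNode G H T x) := by
  have href := refutesNode_iff hg (hS.restrict hT) (hT.trans hM) hx
  rw [GuestList.pruneNode, LooseSim.pruneNode]
  split_ifs with h₁ h₂ h₂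
  · exact (S.restrict_removeNode T x).symm
  · exact absurd (href.1 h₁) h₂
  · exact absurd (href.2 h₂) h₁
  · rfl

theorem pruneRound_restrict (hg : g.Represents G) (hS : S.Represents M)
    (hM : M ≤ G.toHostGraph.prod H) (hT : T ≤ M) :
    g.pruneRound (S.restrict T) = S.restrict (LooseSim.pruneRound G H
      (enumerationOfList hS.nodes.1) (enumerationOfList hS.edges.1) T) := by
  rw [GuestList.pruneRound, LooseSim.pruneRound,
    enumerationOfList_toList _ fun x hx => (hS.nodes.2 x).2 (hT.2.1 hx)]
  refine foldl_comm_of_le (pruneNode_pruneEdges_le G H _) fun T' hT' x hx => ?_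
  have hT'M := hT'.trans hT
  have hxT : x ∈ T.nodes := of_decide_eq_true (List.mem_filter.1 hx).2
  have hxG : x.1 ∈ G.nodes := (Finset.mem_product.1 (hM.2.1 (hT.2.1 hxT))).1
  rw [pruneEdges_restrict hg hS hM hT'M hxG,
    pruneNode_restrict hg hS hM ((pruneEdges_le G H _ T' x).trans hT'M) hxG]

theorem iterate_pruneRound_restrict (hg : g.Represents G) (hS : S.Represents M)
    (hM : M ≤ G.toHostGraph.prod H) (n : ℕ) :
    g.pruneRound^[n] S = S.restrict ((LooseSim.pruneRound G H (enumerationOfList hS.nodes.1)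
      (enumerationOfList hS.edges.1))^[n] M) := by
  induction n with
  | zero => exact hS.restrict_self.symm
  | succ n ih =>
    rw [Function.iterate_succ_apply', Function.iterate_succ_apply', ih,
      pruneRound_restrict hg hS hM (iterate_pruneRound_le ..)]

theorem exists_pruningRun_prune (hg : g.Represents G) (hh : h.Represents H) :
    ∃ T ≤ G.toHostGraph.prod H, (g.prune h).Represents T ∧
      ∃ ordV ordE n, PruningRun G H ordV ordE n (pruneReturn G H T) := by
  have hP := hg.graph.prod hh
  have hcard : (G.toHostGraph.prod H).card ≤
      (g.graph.prod h).nodes.length + (g.graph.prod h).edges.length := by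
    rw [hP.nodes.length_eq_card, hP.edges.length_eq_card, HostGraph.card]
  obtain ⟨n, -, hrun⟩ := exists_pruningRun_iterate G H (enumerationOfList hP.nodes.1)
    (enumerationOfList hP.edges.1) hcard
  refine ⟨_, iterate_pruneRound_le .., ?_, _, _, n, hrun⟩
  rw [prune, iterate_pruneRound_restrict hg hP le_rfl]
  exact hP.restrict (iterate_pruneRound_le ..)

theorem mustOccurs_iff (hg : g.Represents G) (hS : S.Represents T)
    (hT : T ≤ G.toHostGraph.prod H) :
    g.MustOccurs S ↔ ∀ m ∈ G.must, ∃ v ∈ H.nodes, (m, v) ∈ T.nodes := by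
  simp only [MustOccurs, hg.must, hS.nodes.2]
  refine forall₂_congr fun m _ => ⟨?_, fun ⟨v, _, hv⟩ => ⟨(m, v), hv, rfl⟩⟩
  rintro ⟨⟨_, v⟩, hx, rfl⟩
  exact ⟨v, (Finset.mem_product.1 (hT.2.1 hx)).2, hx⟩

end GuestList

end Correctness

/-! ### Polynomial-time solvability -/

section Codes

theorem isListing_iff {α : Type u} [DataEncoding α] {s : Finset α} {d : Data} :
    IsListing (fun a c => c = code a) s d ↔ ∃ l, Lists l s ∧ d = code l := by
  have hcode (l : List α) (ds : List Data) :
      List.Forall₂ (fun a c => c = code a) l ds ↔ l.map code = ds := by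
    rw [← List.forall₂_eq_eq_eq, List.forall₂_map_left_iff]
    simp only [eq_comm]
  simp only [IsListing, hcode]
  constructor
  · rintro ⟨l, _, hnd, hmem, rfl, rfl⟩
    exact ⟨l, ⟨hnd, hmem⟩, rfl⟩
  · rintro ⟨l, hl, rfl⟩
    exact ⟨l, _, hl.1, hl.2, rfl, rfl⟩

theorem IsListing.exists_list {α : Type u} {β : Type v} [DataEncoding β] {R : α → Data → Prop}
    {Q : α → β → Prop} {s : Finset α} {d : Data} (h : IsListing R s d)
    (hR : ∀ a c, R a c → ∃ b, Q a b ∧ c = code b) :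
    ∃ l : List β, d = code l ∧ (∀ a ∈ s, ∃ b ∈ l, Q a b) ∧ ∀ b ∈ l, ∃ a ∈ s, Q a b := by
  obtain ⟨l, ds, -, hs, hl, rfl⟩ := h
  simp only [← hs]
  clear hs
  induction hl with
  | nil => exact ⟨[], rfl, by simp, by simp⟩
  | cons hac _ ih =>
    obtain ⟨m, hm, hlm, hml⟩ := ih
    obtain ⟨b, hab, rfl⟩ := hR _ _ hac
    refine ⟨b :: m, by rw [Data.ofList, hm, code_cons], ?_, ?_⟩
    · simp only [List.mem_cons, forall_eq_or_imp, exists_eq_or_imp]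
      exact ⟨Or.inl hab, fun a' ha' => Or.inr (hlm a' ha')⟩
    · simp only [List.mem_cons, forall_eq_or_imp, exists_eq_or_imp]
      exact ⟨Or.inl hab, fun b' hb' => Or.inr (hml b' hb')⟩

theorem isGraphCode_iff {N : Type u} [DataEncoding N] {M : HostGraph Data N} {d : Data} :
    IsGraphCode code M d ↔ ∃ S : GraphList Data N, S.Represents M ∧ d = code S := by
  have hnodes : IsListing (fun a c => c = a) M.symbols = IsListing (fun a c => c = code a) _ := rfl
  have hedges : IsListing (fun e c => c = edgeCode code e) M.edges =
      IsListing (fun e c => c = code e) _ := rfl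
  simp only [IsGraphCode, hnodes, hedges, isListing_iff]
  constructor
  · rintro ⟨_, _, _, rfl, ⟨σ, hσ, rfl⟩, ⟨V, hV, rfl⟩, ⟨E, hE, rfl⟩⟩
    exact ⟨⟨σ, V, E⟩, ⟨hσ, hV, hE⟩, rfl⟩
  · rintro ⟨S, hS, rfl⟩
    exact ⟨_, _, _, rfl, ⟨_, hS.symbols, rfl⟩, ⟨_, hS.nodes, rfl⟩, ⟨_, hS.edges, rfl⟩⟩

theorem exists_choiceSets_of_isListing {α : Type u} [DataEncoding α] [DecidableEq α]
    {s : Finset (Finset α)} {d : Data}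
    (h : IsListing (IsListing fun e c => c = code e) s d) :
    ∃ k : List (List α), d = code k ∧ ∀ γ, γ ∈ s ↔ ∃ l ∈ k, l.toFinset = γ := by
  obtain ⟨k, hd, hsk, hks⟩ := h.exists_list
    (Q := fun (γ : Finset α) (l : List α) => l.toFinset = γ) fun γ c hγ => by
      obtain ⟨l, hl, rfl⟩ := isListing_iff.1 hγ
      exact ⟨l, Finset.ext fun a => List.mem_toFinset.trans (hl.2 a), rfl⟩
  refine ⟨k, hd, fun γ => ⟨hsk γ, ?_⟩⟩
  rintro ⟨l, hl, rfl⟩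
  obtain ⟨γ, hγ, rfl⟩ := hks l hl
  exact hγ

theorem IsGuestCode.exists_represents {G : Guest Data Data} {d : Data} (h : IsGuestCode G d) :
    ∃ g : GuestList Data Data, g.Represents G ∧ d = code g := by
  obtain ⟨_, _, _, _, _, rfl, hG, hM, hU, hI, hC⟩ := h
  obtain ⟨g, hg, rfl⟩ := isGraphCode_iff.1 hG
  obtain ⟨M, hMl, rfl⟩ := isListing_iff.1 hM
  obtain ⟨U, -, rfl⟩ := isListing_iff.1 hU
  obtain ⟨I, -, rfl⟩ := isListing_iff.1 hI
  obtain ⟨C, rfl, hGC, hCG⟩ := hC.exists_list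
    (Q := fun x (c : Data × List (List (Data × Data × Data))) =>
      c.1 = x ∧ ∀ γ, γ ∈ G.choice x ↔ ∃ k ∈ c.2, k.toFinset = γ) (by
    rintro x _ ⟨_, rfl, hx⟩
    obtain ⟨k, rfl, hk⟩ := exists_choiceSets_of_isListing hx
    exact ⟨(x, k), ⟨rfl, hk⟩, rfl⟩)
  refine ⟨⟨g, M, U, I, C⟩, ⟨hg, hMl.2, fun x hx γ => ⟨fun hγ => ?_, ?_⟩⟩, rfl⟩
  · obtain ⟨c, hc, hcx, hch⟩ := hGC x hx
    exact ⟨c, hc, hcx, (hch γ).1 hγ⟩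
  · rintro ⟨c, hc, rfl, hγ⟩
    obtain ⟨_, -, rfl, hch⟩ := hCG c hc
    exact (hch γ).2 hγ

theorem IsInputCode.exists_represents {i : Guest Data Data × HostGraph Data Data} {d : Data}
    (h : IsInputCode i d) : ∃ (g : GuestList Data Data) (h : GraphList Data Data),
      g.Represents i.1 ∧ h.Represents i.2 ∧ d = code (g, h) := by
  obtain ⟨_, _, rfl, hG, hH⟩ := h
  obtain ⟨g, hg, rfl⟩ := hG.exists_represents
  obtain ⟨h, hh, rfl⟩ := isGraphCode_iff.1 hH
  exact ⟨g, h, hg, hh, rfl⟩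

end Codes

theorem PolyTime.polyTimeSolvable {ι : Type u} {α : Type v} {β : Type w} [DataEncoding α]
    [DataEncoding β] {f : α → β} (hf : PolyTime f) {input output : ι → Data → Prop}
    (h : ∀ i x, input i x → ∃ a, x = code a ∧ output i (code (f a))) :
    PolyTimeSolvable input output := by
  obtain ⟨P, p, hP⟩ := hf
  refine ⟨P, p, fun i x hx => ?_⟩
  obtain ⟨a, rfl, ha⟩ := h i x hx
  obtain ⟨t, ht, hrun⟩ := hP a
  exact ⟨t, _, hrun, ht, ha⟩

theorem polyTimeSolvable_pruneRound : PolyTimeSolvable IsRoundInput fun i y =>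
    ∃ ordV ordE, IsResultCode (some (pruneRound i.1.1 i.1.2 ordV ordE i.2)) y := by
  have hf : PolyTime fun a : (GuestList Data Data × GraphList Data Data) ×
    GraphList Data (Data × Data) => a.1.1.pruneRound a.2 := by fun_prop
  refine hf.polyTimeSolvable ?_
  rintro ⟨⟨G, H⟩, M⟩ _ ⟨hM, _, _, rfl, ⟨-, -, hI⟩, hMc⟩
  obtain ⟨g, h, hg, -, rfl⟩ := hI.exists_represents
  obtain ⟨S, hS, rfl⟩ := isGraphCode_iff.1 hMc
  have hround := GuestList.pruneRound_restrict hg hS hM le_rfl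
  rw [hS.restrict_self] at hround
  exact ⟨((g, h), S), rfl, _, _,
    isGraphCode_iff.2 ⟨_, hS.restrict (pruneRound_le ..), congrArg code hround⟩⟩

theorem exists_represents_prune {G : Guest Data Data} {H : HostGraph Data Data}
    {g : GuestList Data Data} {h : GraphList Data Data} (hU : G.unique = ∅)
    (hI : G.exclusive = ∅) (hg : g.Represents G) (hh : h.Represents H) :
    ∃ T, (g.prune h).Represents T ∧
      IsPruningResult G H (if g.MustOccurs (g.prune h) then some T else none) := by
  obtain ⟨T, hT, hgh, _, _, _, hrun⟩ := GuestList.exists_pruningRun_prune hg hh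
  refine ⟨T, hgh, ?_⟩
  simp only [GuestList.mustOccurs_iff hg hgh hT]
  simpa only [pruneReturn] using hrun.isPruningResult hU hI

theorem polyTimeSolvable_result : PolyTimeSolvable IsFragmentInput fun i y =>
    ∃ r, IsResultCode r y ∧ (∀ ordV ordE, ∃ n, PruningRun i.1 i.2 ordV ordE n r) ∧
      IsPruningResult i.1 i.2 r := by
  have hf : PolyTime fun a : GuestList Data Data × GraphList Data Data =>
      if a.1.MustOccurs (a.1.prune a.2) then code (a.1.prune a.2) else Data.nil := by fun_prop
  refine hf.polyTimeSolvable ?_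
  rintro ⟨G, H⟩ _ ⟨hU, hI, hin⟩
  obtain ⟨g, h, hg, hh, rfl⟩ := hin.exists_represents
  obtain ⟨T, hT, hr⟩ := exists_represents_prune hU hI hg hh
  refine ⟨(g, h), rfl, _, ?_, fun ordV ordE => ?_, hr⟩
  · split_ifs
    · exact isGraphCode_iff.2 ⟨_, hT, rfl⟩
    · rfl
  obtain ⟨n, -, hrun⟩ := exists_pruningRun_iterate G H ordV ordE le_rfl
  exact ⟨n, hr.unique (hrun.isPruningResult hU hI) ▸ hrun⟩

theorem polyTimeSolvable_emptiness : PolyTimeSolvable IsFragmentInput fun i y =>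
    (LGS i.1 i.2 = ∅ ∧ y = Data.tt) ∨ (LGS i.1 i.2 ≠ ∅ ∧ y = Data.nil) := by
  have hf : PolyTime fun a : GuestList Data Data × GraphList Data Data =>
      decide (¬a.1.MustOccurs (a.1.prune a.2)) := by fun_prop
  refine hf.polyTimeSolvable ?_
  rintro ⟨G, H⟩ _ ⟨hU, hI, hin⟩
  obtain ⟨g, h, hg, hh, rfl⟩ := hin.exists_represents
  obtain ⟨T, -, -, hr⟩ := exists_represents_prune hU hI hg hh
  refine ⟨(g, h), rfl, ?_⟩
  by_cases hocc : g.MustOccurs (g.prune h)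
  · exact Or.inr ⟨by simpa [hocc] using hr, by simp [hocc, code]⟩
  · exact Or.inl ⟨by simpa [hocc] using hr, by simp [hocc, code]⟩

end LooseSim

theorem mainTheorem2 :
    -- the greatest loose graph simulation exists as soon as there is any, and the pruning
    -- algorithm halts and returns it, or "false" if there is none
    (∀ {L : Type*} {N : Type*} {N' : Type*} [DecidableEq L] [DecidableEq N] [DecidableEq N']
      (G : Guest L N) (H : HostGraph L N'), G.unique = ∅ → G.exclusive = ∅ →
      ((LGS G H).Nonempty → ∃ S, IsGreatest (LGS G H) S) ∧
      ∀ (ordV : Enumeration (N × N')) (ordE : Enumeration ((N × N') × L × (N × N'))),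
        ∃ (n : ℕ) (r : Option (HostGraph L (N × N'))), PruningRun G H ordV ordE n r ∧
          n ≤ (G.toHostGraph.prod H).nodes.card + (G.toHostGraph.prod H).edges.card + 1 ∧
          (∀ S, r = some S ↔ IsGreatest (LGS G H) S) ∧
          (r = none ↔ LGS G H = ∅)) ∧
    -- one round of the algorithm (for some order of its inner loops) takes polynomial time
    PolyTimeSolvable IsRoundInput (fun i y =>
      ∃ ordV ordE, IsResultCode (some (pruneRound i.1.1 i.1.2 ordV ordE i.2)) y) ∧
    -- the result of the algorithm, the greatest loose graph simulation or "false", is computed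
    -- in polynomial time
    PolyTimeSolvable IsFragmentInput (fun i y =>
      ∃ r, IsResultCode r y ∧ (∀ ordV ordE, ∃ n, PruningRun i.1 i.2 ordV ordE n r) ∧
        (∀ S, r = some S ↔ IsGreatest (LGS i.1 i.2) S) ∧ (r = none ↔ LGS i.1 i.2 = ∅)) ∧
    -- the emptiness problem is decided in polynomial time
    PolyTimeSolvable IsFragmentInput (fun i y =>
      (LGS i.1 i.2 = ∅ ∧ y = Data.tt) ∨ (LGS i.1 i.2 ≠ ∅ ∧ y = Data.nil)) := by
  refine ⟨fun G H hU hI => ⟨exists_isGreatest_of_nonempty hU hI, fun ordV ordE => ?_⟩,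
    polyTimeSolvable_pruneRound, polyTimeSolvable_result, polyTimeSolvable_emptiness⟩
  obtain ⟨n, hn, hrun⟩ := exists_pruningRun_iterate G H ordV ordE le_rfl
  exact ⟨n, _, hrun, hn, hrun.isPruningResult hU hI⟩
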